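/- Let $G$ be a Lie group with Lie algebra $\mathfrak g$ acting smoothly, freely and properly on a manifold $Q$, let $L:TQ\to\mathbb R$ be a smooth $G$-invariant Lagrangian, and let $\gamma$ be a principal connection on $Q\to Q/G$ with horizontal distribution $\mathcal D=\ker\gamma$. Let $M\subset TQ$ be a smooth $G$-invariant affine constraint with linear part $\mathcal D$, that is $M_q=Z(q)+\mathcal D_q$ for a smooth vector field $Z$ on $Q$. (Such constraints are admissible.) Assume the compatibility condition: along $M$, the fibre Hessian of $L$ is invertible and its inverse, a bilinear form on $T_q^*Q$, is nondegenerate on the annihilator $\mathcal D_q^o$. A nonholonomic solution is a $C^2$ curve $q(t)$, $t$ in an open interval $J$, with $\dot q(t)\in M$ and $\frac{d}{dt}\frac{\partial L}{\partial\dot q^A}-\frac{\partial L}{\partial q^A}=\lambda_\alpha\frac{\partial\Phi^\alpha}{\partial\dot q^A}$ for some multipliers $\lambda_\alpha$, where $\Phi^\alpha=0$ are the local equations of $M$ given by the components of $\gamma(\dot q-Z(q))=0$. On $W_0=T^*Q\times_QM$ let $\omega=dq^A\wedge dp_A$ be the pull-back of the canonical two-form of $T^*Q$, and $H_{W_0}(p,v)=\langle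 p,v\rangle-L(v)$. Let $W_1\subset W_0$ be the set of $(p,v)$ with $p=\mathbb FL(v)$ on $\mathcal D$, where $\mathbb FL$ is the fibre derivative. A vakonomic solution is a curve in $W_1$ whose tangent vector $X$ satisfies $i_X\omega=dH_{W_0}$ on $W_0$. A point of $W_1$ over $v\in M_q$ is determined by the vertical part of $p$, that is, by the element $p_0\in\mathfrak g^*$ with $\langle p_0,\xi\rangle=\langle p,\xi_Q(q)\rangle$ for $\xi\in\mathfrak g$, where $\xi_Q$ is the infinitesimal generator; we write $(v,p_0)$ for this point. In local coordinates $(q^a,q^\alpha)$ of $Q$ in which $M$ reads $\dot q^\alpha=\Psi^\alpha_a(q)\dot q^a+\psi^\alpha(q)$, put $$g_b=\Big(p_\alpha-\frac{\partial L}{\partial\dot q^\alpha}\Big)\big(\dot q^aR^\alpha_{ab}+R^\alpha_{0b}\big),$$ $$R^\alpha_{ab}=\frac{\partial\Psi^\alpha_b}{\partial q^a}-\frac{\partial\Psi^\alpha_a}{\partial q^b}+\Psi^\beta_a\frac{\partial\Psi^\alpha_b}{\partial q^\beta}-\Psi^\beta_b\frac{\partial\Psi^\alpha_a}{\partial q^\beta},\qquad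 R^\alpha_{0b}=\psi^\beta\frac{\partial\Psi^\alpha_b}{\partial q^\beta}-\frac{\partial\psi^\alpha}{\partial q^b}-\Psi^\beta_b\frac{\partial\psi^\alpha}{\partial q^\beta}.$$ Proposition. Let $q(t)$, $t\in J$, be a nonholonomic solution. For every (constant) $p_0\in\mathfrak g^*$ the following are equivalent: 1. for every $t\in J$ and every such coordinate system around $q(t)$, all $g_b$ vanish at the point $(\dot q(t),p_0)$ of $W_1$; 2. for every $t\in J$ there is such a coordinate system around $q(t)$ in which all $g_b$ vanish at $(\dot q(t),p_0)$; 3. the curve $t\mapsto(\dot q(t),p_0)$ in $W_1$ is a vakonomic solution. -/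

import Mathlib

open Set Filter Topology
open scoped Manifold ContDiff

noncomputable section

namespace ConstrainedMechanics

/- Throughout, `B` and `F` are finite-dimensional real vector spaces, `G` is a Lie group of
dimension `dim F`, and `Q` is a manifold of dimension `dim B + dim F` on which `G` acts.
A coordinate system on `Q` takes values in `B × F`: the `B`-part collects the coordinates `q^a`
and the `F`-part the coordinates `q^α`. The tangent space of `Q` is modelled on `B × F` and the
Lie algebra of `G` on `F`. -/

section Geometry

variable (B F G : Type*)
  [NormedAddCommGroup B] [NormedSpace ℝ B] [NormedAddCommGroup F] [NormedSpace ℝ F]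
  [TopologicalSpace G] [ChartedSpace F G] [Group G]

/-- The adjoint action of `g` on the Lie algebra: the derivative at `1` of `h ↦ g h g⁻¹`. -/
def adjoint (g : G) : GroupLieAlgebra 𝓘(ℝ, F) G →L[ℝ] GroupLieAlgebra 𝓘(ℝ, F) G :=
  (mfderiv 𝓘(ℝ, F) 𝓘(ℝ, F) (fun h : G => g * h * g⁻¹) 1 : F →L[ℝ] F)

variable (Q : Type*) [TopologicalSpace Q] [ChartedSpace (B × F) Q] [MulAction G Q]

/-- The infinitesimal generator `ξ ↦ ξ_Q(q)` of the action at `q`: the derivative at `1` of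
the orbit map `g ↦ g • q`. -/
def generator (q : Q) : GroupLieAlgebra 𝓘(ℝ, F) G →L[ℝ] TangentSpace 𝓘(ℝ, B × F) q :=
  (mfderiv 𝓘(ℝ, F) 𝓘(ℝ, B × F) (fun g : G => g • q) 1 : F →L[ℝ] (B × F))

/-- The tangent lift `TΘ_g : TQ → TQ` of the action. -/
def liftAction (g : G) : TangentBundle 𝓘(ℝ, B × F) Q → TangentBundle 𝓘(ℝ, B × F) Q :=
  tangentMap 𝓘(ℝ, B × F) 𝓘(ℝ, B × F) (fun q : Q => g • q)

variable [IsManifold 𝓘(ℝ, B × F) ∞ Q]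

/-- A principal connection on `Q → Q/G`: a smooth `𝔤`-valued one-form which reproduces the
infinitesimal generators and is equivariant. -/
structure PrincipalConnection where
  form : ∀ q : Q, TangentSpace 𝓘(ℝ, B × F) q →L[ℝ] GroupLieAlgebra 𝓘(ℝ, F) G
  smooth : ContMDiff (M' := F) 𝓘(ℝ, B × F).tangent 𝓘(ℝ, F) ∞
    (fun v : TangentBundle 𝓘(ℝ, B × F) Q => form v.proj v.2)
  form_generator : ∀ (q : Q) (ξ : GroupLieAlgebra 𝓘(ℝ, F) G),
    form q (generator B F G Q q ξ) = ξ
  equivariant : ∀ (g : G) (v : TangentBundle 𝓘(ℝ, B × F) Q),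
    form (liftAction B F G Q g v).proj (liftAction B F G Q g v).2 =
      adjoint F G g (form v.proj v.2)

end Geometry

section Mechanics

set_option linter.unusedSectionVars false

variable {B F G : Type*}
  [NormedAddCommGroup B] [NormedSpace ℝ B] [NormedAddCommGroup F] [NormedSpace ℝ F]
  [TopologicalSpace G] [ChartedSpace F G] [Group G]
  {Q : Type*} [TopologicalSpace Q] [ChartedSpace (B × F) Q] [MulAction G Q]
  [IsManifold 𝓘(ℝ, B × F) ∞ Q]

/-- The horizontal distribution `D = ker γ`. -/
def PrincipalConnection.horizontal (γ : PrincipalConnection B F G Q) (q : Q) :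
    Submodule ℝ (TangentSpace 𝓘(ℝ, B × F) q) :=
  LinearMap.ker (γ.form q).toLinearMap

/-- The affine constraint set `M ⊆ TQ` with fibres `M_q = Z(q) + D_q`. -/
def affineConstraint (γ : PrincipalConnection B F G Q)
    (Z : ∀ q : Q, TangentSpace 𝓘(ℝ, B × F) q) : Set (TangentBundle 𝓘(ℝ, B × F) Q) :=
  {v | v.2 - Z v.proj ∈ γ.horizontal v.proj}

/-- The fibre derivative `FL(v) = ∂L/∂q̇ ∈ T*_qQ` of `L` at `v ∈ T_qQ`. -/
def fiberDeriv (L : TangentBundle 𝓘(ℝ, B × F) Q → ℝ) (v : TangentBundle 𝓘(ℝ, B × F) Q) :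
    TangentSpace 𝓘(ℝ, B × F) v.proj →L[ℝ] ℝ :=
  (fderiv ℝ (fun w : B × F => L ⟨v.proj, w⟩) v.2 : (B × F) →L[ℝ] ℝ)

/-- The fibre Hessian `∂²L/∂q̇^A∂q̇^B` of `L` at `v ∈ T_qQ`, as a map `T_qQ → T*_qQ`. -/
def fiberHessian (L : TangentBundle 𝓘(ℝ, B × F) Q → ℝ) (v : TangentBundle 𝓘(ℝ, B × F) Q) :
    (B × F) →L[ℝ] ((B × F) →L[ℝ] ℝ) :=
  fderiv ℝ (fderiv ℝ (fun w : B × F => L ⟨v.proj, w⟩)) v.2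

/-- The compatibility condition: along `M`, the Hessian of `L` is invertible and its inverse
`W = (W^{AB})` restricts to a nondegenerate bilinear form on the annihilator of `D`. The
annihilator is `{a ∘ γ | a ∈ 𝔤*}`, and `b (γ (W (a ∘ γ)))` is the matrix `𝒞^{αβ}`. -/
def Compatible (γ : PrincipalConnection B F G Q) (Z : ∀ q : Q, TangentSpace 𝓘(ℝ, B × F) q)
    (L : TangentBundle 𝓘(ℝ, B × F) Q → ℝ) : Prop :=
  ∀ v ∈ affineConstraint γ Z, (fiberHessian L v).IsInvertible ∧
    ∀ a : GroupLieAlgebra 𝓘(ℝ, F) G →L[ℝ] ℝ,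
      (∀ b : GroupLieAlgebra 𝓘(ℝ, F) G →L[ℝ] ℝ,
        b (γ.form v.proj ((fiberHessian L v).inverse (a.comp (γ.form v.proj)))) = 0) → a = 0

/-! ### Coordinate expressions -/

/-- `L(x, ẋ)` in the coordinate system `e`. -/
def localLagrangian (L : TangentBundle 𝓘(ℝ, B × F) Q → ℝ)
    (e : OpenPartialHomeomorph Q (B × F)) (x : (B × F) × (B × F)) : ℝ :=
  L ⟨e.symm x.1, mfderiv 𝓘(ℝ, B × F) 𝓘(ℝ, B × F) e.symm x.1 x.2⟩

/-- The constraint functions `Φ(x, ẋ) = γ(ẋ - Z)` in the coordinate system `e`, collected into a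
single `𝔤`-valued function; `M` is the zero set. -/
def localConstraint (γ : PrincipalConnection B F G Q)
    (Z : ∀ q : Q, TangentSpace 𝓘(ℝ, B × F) q)
    (e : OpenPartialHomeomorph Q (B × F)) (x : (B × F) × (B × F)) : F :=
  γ.form (e.symm x.1)
    (mfderiv 𝓘(ℝ, B × F) 𝓘(ℝ, B × F) e.symm x.1 x.2 - Z (e.symm x.1))

/-- The coordinates `dq(v)` of a tangent vector `v ∈ T_qQ`. -/
def localVector (e : OpenPartialHomeomorph Q (B × F)) (v : TangentBundle 𝓘(ℝ, B × F) Q) :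
    B × F :=
  mfderiv 𝓘(ℝ, B × F) 𝓘(ℝ, B × F) e v.proj v.2

/-- The coordinates `(p_A)` of a covector `p ∈ T*_qQ`. -/
def localCovector (e : OpenPartialHomeomorph Q (B × F)) (q : Q)
    (p : TangentSpace 𝓘(ℝ, B × F) q →L[ℝ] ℝ) : (B × F) →L[ℝ] ℝ :=
  p.comp (mfderiv 𝓘(ℝ, B × F) 𝓘(ℝ, B × F) e q).inverse

/-- The velocity `q̇(t) ∈ T_{q(t)}Q` of a curve in `Q`. -/
def velocity (q : ℝ → Q) (t : ℝ) : TangentBundle 𝓘(ℝ, B × F) Q :=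
  ⟨q t, mfderiv 𝓘(ℝ, ℝ) 𝓘(ℝ, B × F) q t (1 : ℝ)⟩

/-! ### Nonholonomic solutions -/

/-- The Euler-Lagrange covector `d/dt (∂L/∂ẋ) - ∂L/∂x` along a curve `x` in coordinates. -/
def eulerLagrange (l : (B × F) × (B × F) → ℝ) (x : ℝ → B × F) (t : ℝ) : (B × F) →L[ℝ] ℝ :=
  deriv (fun s => (fderiv ℝ l (x s, deriv x s)).comp
      (ContinuousLinearMap.inr ℝ (B × F) (B × F))) t -
    (fderiv ℝ l (x t, deriv x t)).comp (ContinuousLinearMap.inl ℝ (B × F) (B × F))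

/-- A solution of the nonholonomic problem: a `C²` curve with velocity in `M` which satisfies, in
every coordinate system, `d/dt (∂L/∂q̇^A) - ∂L/∂q^A = λ_α ∂Φ^α/∂q̇^A` for some multipliers `λ`. -/
structure IsNonholonomicSolution (γ : PrincipalConnection B F G Q)
    (Z : ∀ q : Q, TangentSpace 𝓘(ℝ, B × F) q) (L : TangentBundle 𝓘(ℝ, B × F) Q → ℝ)
    (J : Set ℝ) (q : ℝ → Q) : Prop where
  contMDiffOn : ContMDiffOn 𝓘(ℝ, ℝ) 𝓘(ℝ, B × F) 2 q J
  velocity_mem : ∀ t ∈ J, velocity q t ∈ affineConstraint γ Z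
  equation : ∀ t ∈ J, ∀ e ∈ IsManifold.maximalAtlas 𝓘(ℝ, B × F) ∞ Q, q t ∈ e.source →
    ∃ lam : F →L[ℝ] ℝ,
      eulerLagrange (localLagrangian L e) (fun s => e (q s)) t =
        lam.comp ((fderiv ℝ (localConstraint γ Z e) (e (q t), deriv (fun s => e (q s)) t)).comp
          (ContinuousLinearMap.inr ℝ (B × F) (B × F)))

/-! ### Vakonomic solutions -/

/-- The canonical two-form `dx ∧ dp` in coordinates `(x, p, v)` on `T*Q ⊕ TQ`. -/
def presymplectic (X Y : (B × F) × ((B × F) →L[ℝ] ℝ) × (B × F)) : ℝ :=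
  Y.2.1 X.1 - X.2.1 Y.1

/-- The Hamiltonian `⟨p, v⟩ - L(x, v)` in coordinates `(x, p, v)` on `T*Q ⊕ TQ`. -/
def localHamiltonian (l : (B × F) × (B × F) → ℝ)
    (w : (B × F) × ((B × F) →L[ℝ] ℝ) × (B × F)) : ℝ :=
  w.2.1 w.2.2 - l (w.1, w.2.2)

/-- The curve `(x(t), p(t), v(t))` in coordinates which represents a curve
`(p(t), v(t)) ∈ T*_{q(t)}Q × T_{q(t)}Q`. -/
def localCurve (e : OpenPartialHomeomorph Q (B × F)) (v : ℝ → TangentBundle 𝓘(ℝ, B × F) Q)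
    (p : ∀ t, TangentSpace 𝓘(ℝ, B × F) (v t).proj →L[ℝ] ℝ) (t : ℝ) :
    (B × F) × ((B × F) →L[ℝ] ℝ) × (B × F) :=
  (e (v t).proj, localCovector e (v t).proj (p t), localVector e (v t))

/-- The points `(p, v)` of the first constraint submanifold `W₁` of `W₀ = T*Q ×_Q M`: those at
which `dH_{W₀} = p - FL(v)` vanishes on `ker ω`, the directions of `M` tangent to the fibre. -/
def MemW₁ (γ : PrincipalConnection B F G Q) (Z : ∀ q : Q, TangentSpace 𝓘(ℝ, B × F) q)
    (L : TangentBundle 𝓘(ℝ, B × F) Q → ℝ) (v : TangentBundle 𝓘(ℝ, B × F) Q)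
    (p : TangentSpace 𝓘(ℝ, B × F) v.proj →L[ℝ] ℝ) : Prop :=
  v ∈ affineConstraint γ Z ∧ ∀ w ∈ γ.horizontal v.proj, p w = fiberDeriv L v w

/-- A vakonomic solution: a curve `(p(t), v(t))` in `W₁` which satisfies `i_X ω = dH_{W₀}` on
`W₀ = T*Q ×_Q M`, `X` being its tangent vector. In coordinates, the tangent vectors `δ` of `W₀`
are those annihilated by the differential of the constraint functions. -/
structure IsVakonomicSolution (γ : PrincipalConnection B F G Q)
    (Z : ∀ q : Q, TangentSpace 𝓘(ℝ, B × F) q) (L : TangentBundle 𝓘(ℝ, B × F) Q → ℝ)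
    (J : Set ℝ) (v : ℝ → TangentBundle 𝓘(ℝ, B × F) Q)
    (p : ∀ t, TangentSpace 𝓘(ℝ, B × F) (v t).proj →L[ℝ] ℝ) : Prop where
  mem : ∀ t ∈ J, MemW₁ γ Z L (v t) (p t)
  continuousOn : ContinuousOn (fun t => (v t).proj) J
  equation : ∀ t ∈ J, ∀ e ∈ IsManifold.maximalAtlas 𝓘(ℝ, B × F) ∞ Q, (v t).proj ∈ e.source →
    DifferentiableAt ℝ (localCurve e v p) t ∧
    ∀ δ : (B × F) × ((B × F) →L[ℝ] ℝ) × (B × F),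
      fderiv ℝ (localConstraint γ Z e) (e (v t).proj, localVector e (v t)) (δ.1, δ.2.2) = 0 →
      presymplectic (deriv (localCurve e v p) t) δ =
        fderiv ℝ (localHamiltonian (localLagrangian L e)) (localCurve e v p t) δ

/-- For `v ∈ T_qQ` and `p₀ ∈ 𝔤*`, the covector `p ∈ T*_qQ` of the point `(v, p₀)` of `W₁`: it has
vertical components `p₀`, that is `⟨p, ξ_Q(q)⟩ = ⟨p₀, ξ⟩`, and it agrees with `FL(v)` on `D_q`. -/
def covectorW₁ (γ : PrincipalConnection B F G Q) (L : TangentBundle 𝓘(ℝ, B × F) Q → ℝ)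
    (p₀ : GroupLieAlgebra 𝓘(ℝ, F) G →L[ℝ] ℝ) (v : TangentBundle 𝓘(ℝ, B × F) Q) :
    TangentSpace 𝓘(ℝ, B × F) v.proj →L[ℝ] ℝ :=
  fiberDeriv L v +
    (p₀ - (fiberDeriv L v).comp (generator B F G Q v.proj)).comp (γ.form v.proj)

theorem covectorW₁_generator (γ : PrincipalConnection B F G Q)
    (L : TangentBundle 𝓘(ℝ, B × F) Q → ℝ) (p₀ : GroupLieAlgebra 𝓘(ℝ, F) G →L[ℝ] ℝ)
    (v : TangentBundle 𝓘(ℝ, B × F) Q) (ξ : GroupLieAlgebra 𝓘(ℝ, F) G) :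
    covectorW₁ γ L p₀ v (generator B F G Q v.proj ξ) = p₀ ξ := by
  simp [covectorW₁, γ.form_generator]

theorem memW₁_covectorW₁ (γ : PrincipalConnection B F G Q)
    (Z : ∀ q : Q, TangentSpace 𝓘(ℝ, B × F) q)
    (L : TangentBundle 𝓘(ℝ, B × F) Q → ℝ) (p₀ : GroupLieAlgebra 𝓘(ℝ, F) G →L[ℝ] ℝ)
    (v : TangentBundle 𝓘(ℝ, B × F) Q) (hv : v ∈ affineConstraint γ Z) :
    MemW₁ γ Z L v (covectorW₁ γ L p₀ v) := by
  refine ⟨hv, fun w hw => ?_⟩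
  have h : γ.form v.proj w = 0 := hw
  simp [covectorW₁, h]

/-! ### The functions `g_b` -/

/-- Coordinates `(q^a, q^α)` on `Q` in which `M` is given by
`q̇^α = Ψ^α_a(q) q̇^a + ψ^α(q)`. -/
structure AdaptedCoordinates (γ : PrincipalConnection B F G Q)
    (Z : ∀ q : Q, TangentSpace 𝓘(ℝ, B × F) q) where
  chart : OpenPartialHomeomorph Q (B × F)
  mem_maximalAtlas : chart ∈ IsManifold.maximalAtlas 𝓘(ℝ, B × F) ∞ Q
  Ψ : B × F → (B →L[ℝ] F)
  ψ : B × F → F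
  smooth_Ψ : ContDiffOn ℝ ∞ Ψ chart.target
  smooth_ψ : ContDiffOn ℝ ∞ ψ chart.target
  mem_iff : ∀ v : TangentBundle 𝓘(ℝ, B × F) Q, v.proj ∈ chart.source →
    (v ∈ affineConstraint γ Z ↔
      (localVector chart v).2 =
        Ψ (chart v.proj) (localVector chart v).1 + ψ (chart v.proj))

namespace AdaptedCoordinates

variable {γ : PrincipalConnection B F G Q} {Z : ∀ q : Q, TangentSpace 𝓘(ℝ, B × F) q}

/-- The curvature `R^α_{ab} u^a w^b`, where
`R^α_{ab} = ∂Ψ^α_b/∂q^a - ∂Ψ^α_a/∂q^b + Ψ^β_a ∂Ψ^α_b/∂q^β - Ψ^β_b ∂Ψ^α_a/∂q^β`. -/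
def curvature (c : AdaptedCoordinates γ Z) (x : B × F) (u w : B) : F :=
  fderiv ℝ c.Ψ x (u, c.Ψ x u) w - fderiv ℝ c.Ψ x (w, c.Ψ x w) u

/-- The contribution of the affine part, `R^α_{0b} w^b`, where
`R^α_{0b} = ψ^β ∂Ψ^α_b/∂q^β - ∂ψ^α/∂q^b - Ψ^β_b ∂ψ^α/∂q^β`. It vanishes for linear constraints
(`ψ = 0`). -/
def affineCurvature (c : AdaptedCoordinates γ Z) (x : B × F) (w : B) : F :=
  fderiv ℝ c.Ψ x (0, c.ψ x) w - fderiv ℝ c.ψ x (w, c.Ψ x w)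

/-- The functions `g_b = (p_α - ∂L/∂q̇^α) (q̇^a R^α_{ab} + R^α_{0b})`, with `w` in the place of
the index `b`. -/
def g (c : AdaptedCoordinates γ Z) (L : TangentBundle 𝓘(ℝ, B × F) Q → ℝ)
    (v : TangentBundle 𝓘(ℝ, B × F) Q) (p : TangentSpace 𝓘(ℝ, B × F) v.proj →L[ℝ] ℝ)
    (w : B) : ℝ :=
  localCovector c.chart v.proj (p - fiberDeriv L v)
    (0, c.curvature (c.chart v.proj) (localVector c.chart v).1 w +
      c.affineCurvature (c.chart v.proj) w)

end AdaptedCoordinates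

end Mechanics

end ConstrainedMechanics

end

open ConstrainedMechanics

open Set Filter Topology
open scoped Manifold ContDiff

/-! In a chart the constraint reads A(x)ẋ = a(x), with A the connection form and a = γ(Z). Let C(x)
be the map of infinitesimal generators, so that A C = 1. Along the solution let π = ∂L/∂ẋ, and let μ
= p₀ − π∘C be the defect between p₀ and the momentum of the action. The covector of the point (q̇,
p₀) of W₁ is then p = π + μ∘A.

The nonholonomic equation is π̇ − ∂L/∂x = λ∘A. Invariance of L turns it into the momentum equation
(π∘C)˙ = λ, so μ̇∘A = −λ∘A cancels the multiplier coming from π̇, and ṗ = ∂L/∂x + μ∘Ȧ remains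
(`deriv_correctedMomentum_apply`). In the vakonomic equation the covector components of δ drop out,
because the velocity component of the curve is q̇. For (y, z) tangent to M what is left is μ(Ȧy +
Az) = 0. Tangency says Az = Da(y) − DA(y)ẋ, so the equation becomes μ(K(y)) = 0 with K(y) = DA(ẋ)y −
DA(y)ẋ + Da(y), the `formCurvature`. Invariance of M makes K vanish on vertical vectors
(`formCurvature_vertical`), so only horizontal y matter (`vakonomic_iff_formCurvature`). Both uses
of invariance rest on `fderiv_eq_zero_of_liftAction_invariant`.

In adapted coordinates A = N(dq^α − Ψ dq^a) and a = Nψ. On horizontal lifts K is then −N applied to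
the curvature expression in g_b (`formCurvature_graph`), so the functions g_b are, up to sign, the
components of μ∘K (`g_eq_zero_iff`). Since K is natural under coordinate changes
(`formCurvature_comp`), one adapted chart at each point is as good as all of them, and such charts
exist everywhere (`exists_adaptedCoordinates`). -/

namespace ConstrainedMechanics

/-! ### Calculus in a fixed chart: curvature, corrected momentum, vakonomic equation. -/

section Calculus

variable {E F : Type*} [NormedAddCommGroup E] [NormedSpace ℝ E]
  [NormedAddCommGroup F] [NormedSpace ℝ F]

/-- The Euler-Lagrange expression of the `F`-valued function `(x, v) ↦ A(x) v - a(x)`, evaluated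
on `w`. -/
noncomputable def formCurvature (A : E → E →L[ℝ] F) (a : E → F) (x v w : E) : F :=
  fderiv ℝ A x v w - fderiv ℝ A x w v + fderiv ℝ a x w

theorem hasFDerivAt_affine {A : E → E →L[ℝ] F} {a : E → F} {x v : E}
    (hA : DifferentiableAt ℝ A x) (ha : DifferentiableAt ℝ a x) :
    HasFDerivAt (fun y : E × E => A y.1 y.2 - a y.1)
      ((A x).comp (ContinuousLinearMap.snd ℝ E E) +
        (((fderiv ℝ A x).comp (ContinuousLinearMap.fst ℝ E E)).flip v) -
        (fderiv ℝ a x).comp (ContinuousLinearMap.fst ℝ E E)) (x, v) := by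
  have h1 : HasFDerivAt (fun y : E × E => A y.1)
      ((fderiv ℝ A x).comp (ContinuousLinearMap.fst ℝ E E)) (x, v) :=
    HasFDerivAt.comp (x, v) (g := A) (f := Prod.fst) hA.hasFDerivAt hasFDerivAt_fst
  have h2 : HasFDerivAt (fun y : E × E => a y.1)
      ((fderiv ℝ a x).comp (ContinuousLinearMap.fst ℝ E E)) (x, v) :=
    HasFDerivAt.comp (x, v) (g := a) (f := Prod.fst) ha.hasFDerivAt hasFDerivAt_fst
  exact (h1.clm_apply hasFDerivAt_snd).sub h2

theorem fderiv_affine_apply {A : E → E →L[ℝ] F} {a : E → F} {x v : E}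
    (hA : DifferentiableAt ℝ A x) (ha : DifferentiableAt ℝ a x) (y w : E) :
    fderiv ℝ (fun y : E × E => A y.1 y.2 - a y.1) (x, v) (y, w) =
      A x w + fderiv ℝ A x y v - fderiv ℝ a x y := by
  rw [(hasFDerivAt_affine hA ha).fderiv]
  simp

/-- Naturality of the curvature under a change of coordinates `φ`. -/
theorem formCurvature_comp {E' : Type*} [NormedAddCommGroup E'] [NormedSpace ℝ E']
    {A : E → E →L[ℝ] F} {a : E → F} {A' : E' → E' →L[ℝ] F} {a' : E' → F} {φ : E → E'} {x : E}
    (hφ : ContDiffAt ℝ 2 φ x) (hA' : DifferentiableAt ℝ A' (φ x))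
    (ha' : DifferentiableAt ℝ a' (φ x))
    (hA : A =ᶠ[𝓝 x] fun y => (A' (φ y)).comp (fderiv ℝ φ y))
    (ha : a =ᶠ[𝓝 x] fun y => a' (φ y)) (v w : E) :
    formCurvature A a x v w =
      formCurvature A' a' (φ x) (fderiv ℝ φ x v) (fderiv ℝ φ x w) := by
  have hd : DifferentiableAt ℝ φ x := hφ.differentiableAt (by norm_num)
  have hd2 : DifferentiableAt ℝ (fderiv ℝ φ) x :=
    (hφ.fderiv_right (m := 1) (by norm_num)).differentiableAt (by norm_num)
  -- Second derivatives of φ enter only through A'(D²φ(v)w) − A'(D²φ(w)v), which is zero by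
  -- symmetry.
  have hsymm : fderiv ℝ (fderiv ℝ φ) x v w = fderiv ℝ (fderiv ℝ φ) x w v :=
    (hφ.isSymmSndFDerivAt (by simp)).eq v w
  have h1 := (HasFDerivAt.comp x (g := A') hA'.hasFDerivAt hd.hasFDerivAt).clm_comp
    hd2.hasFDerivAt
  have h2 := HasFDerivAt.comp x (g := a') ha'.hasFDerivAt hd.hasFDerivAt
  have h1' := (h1.congr_of_eventuallyEq hA).fderiv
  have h2' := (h2.congr_of_eventuallyEq ha).fderiv
  simp only [formCurvature, h1', h2']
  simp [hsymm]

/-- The curvature in coordinates in which the constraint is solved for some of the velocities. -/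
theorem formCurvature_graph {B : Type*} [NormedAddCommGroup B] [NormedSpace ℝ B]
    {A : B × F → (B × F) →L[ℝ] F} {a : B × F → F} {N : B × F → F →L[ℝ] F}
    {Ψ : B × F → B →L[ℝ] F} {ψ : B × F → F} {x : B × F}
    (hN : DifferentiableAt ℝ N x) (hΨ : DifferentiableAt ℝ Ψ x) (hψ : DifferentiableAt ℝ ψ x)
    (hA : A =ᶠ[𝓝 x] fun y => (N y).comp
      (ContinuousLinearMap.snd ℝ B F - (Ψ y).comp (ContinuousLinearMap.fst ℝ B F)))
    (ha : a =ᶠ[𝓝 x] fun y => N y (ψ y)) (u w : B) :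
    formCurvature A a x (u, Ψ x u + ψ x) (w, Ψ x w) =
      - N x (fderiv ℝ Ψ x (u, Ψ x u) w - fderiv ℝ Ψ x (w, Ψ x w) u +
        (fderiv ℝ Ψ x (0, ψ x) w - fderiv ℝ ψ x (w, Ψ x w))) := by
  have h0 : HasFDerivAt (fun y => ContinuousLinearMap.snd ℝ B F -
      (Ψ y).comp (ContinuousLinearMap.fst ℝ B F)) _ x :=
    (hasFDerivAt_const (ContinuousLinearMap.snd ℝ B F) x).sub
      (hΨ.hasFDerivAt.clm_comp (hasFDerivAt_const (ContinuousLinearMap.fst ℝ B F) x))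
  have h1 := hN.hasFDerivAt.clm_comp h0
  have h2 := hN.hasFDerivAt.clm_apply hψ.hasFDerivAt
  have h1' := (h1.congr_of_eventuallyEq hA).fderiv
  have h2' := (h2.congr_of_eventuallyEq ha).fderiv
  have hs : fderiv ℝ Ψ x (u, Ψ x u + ψ x) =
      fderiv ℝ Ψ x (u, Ψ x u) + fderiv ℝ Ψ x (0, ψ x) := by
    rw [← map_add]; simp
  -- The derivatives of N drop out: DN(v) acts on the F-part of (w, Ψw) minus Ψw, and DN(w) acts on
  -- the F-part of (u, Ψu + ψ) minus Ψu + ψ; both arguments are zero.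
  simp only [formCurvature, h1', h2']
  simp [hs]
  abel

/-- The momentum `∂ℓ/∂v` along a curve `x`. -/
noncomputable def momentum (ℓ : E × E → ℝ) (x : ℝ → E) (t : ℝ) : E →L[ℝ] ℝ :=
  (fderiv ℝ ℓ (x t, deriv x t)).comp (ContinuousLinearMap.inr ℝ E E)

theorem differentiableAt_deriv_of_contDiffAt {x : ℝ → E} {t : ℝ} (hx : ContDiffAt ℝ 2 x t) :
    DifferentiableAt ℝ (deriv x) t := by
  have h : DifferentiableAt ℝ (fderiv ℝ x) t :=
    (hx.fderiv_right (m := 1) (by norm_num)).differentiableAt (by norm_num)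
  have h' : deriv x = fun s => fderiv ℝ x s 1 := by ext s; simp
  rw [h']
  exact h.clm_apply (differentiableAt_const _)

theorem differentiableAt_momentum {ℓ : E × E → ℝ} {x : ℝ → E} {t : ℝ}
    (hℓ : ContDiffAt ℝ 2 ℓ (x t, deriv x t)) (hx : ContDiffAt ℝ 2 x t) :
    DifferentiableAt ℝ (momentum ℓ x) t := by
  have h : DifferentiableAt ℝ (fderiv ℝ ℓ) (x t, deriv x t) :=
    (hℓ.fderiv_right (m := 1) (by norm_num)).differentiableAt (by norm_num)
  have h2 : DifferentiableAt ℝ (fun s => (x s, deriv x s)) t :=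
    (hx.differentiableAt (by norm_num)).prodMk (differentiableAt_deriv_of_contDiffAt hx)
  exact (DifferentiableAt.comp t (g := fderiv ℝ ℓ) h h2).clm_comp (differentiableAt_const _)

/-- The momentum along `x` whose vertical part has been replaced by the constant `p₀`. -/
noncomputable def correctedMomentum (ℓ : E × E → ℝ) (A : E → E →L[ℝ] F) (C : E → F →L[ℝ] E)
    (p₀ : F →L[ℝ] ℝ) (x : ℝ → E) (t : ℝ) : E →L[ℝ] ℝ :=
  momentum ℓ x t + (p₀ - (momentum ℓ x t).comp (C (x t))).comp (A (x t))

theorem hasDerivAt_correctedMomentum {ℓ : E × E → ℝ} {A : E → E →L[ℝ] F} {C : E → F →L[ℝ] E}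
    {x : ℝ → E} {t : ℝ} (hℓ : ContDiffAt ℝ 2 ℓ (x t, deriv x t)) (hx : ContDiffAt ℝ 2 x t)
    (hA : DifferentiableAt ℝ A (x t)) (hC : DifferentiableAt ℝ C (x t)) (p₀ : F →L[ℝ] ℝ) :
    HasDerivAt (correctedMomentum ℓ A C p₀ x)
      (deriv (momentum ℓ x) t +
        ((0 - ((deriv (momentum ℓ x) t).comp (C (x t)) +
          (momentum ℓ x t).comp (fderiv ℝ C (x t) (deriv x t)))).comp (A (x t)) +
        (p₀ - (momentum ℓ x t).comp (C (x t))).comp (fderiv ℝ A (x t) (deriv x t)))) t := by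
  have hxd := (hx.differentiableAt (by norm_num)).hasDerivAt
  have hm := (differentiableAt_momentum hℓ hx).hasDerivAt
  have h1 := hA.hasFDerivAt.comp_hasDerivAt t hxd
  have h2 := hC.hasFDerivAt.comp_hasDerivAt t hxd
  exact hm.add (((hasDerivAt_const t p₀).sub (hm.clm_comp h2)).clm_comp h1)

/-- For a nonholonomic solution with symmetry, the derivative of the corrected momentum. -/
theorem deriv_correctedMomentum_apply {ℓ : E × E → ℝ} {A : E → E →L[ℝ] F}
    {C : E → F →L[ℝ] E} {x : ℝ → E} {t : ℝ}
    (hℓ : ContDiffAt ℝ 2 ℓ (x t, deriv x t)) (hx : ContDiffAt ℝ 2 x t)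
    (hA : DifferentiableAt ℝ A (x t)) (hC : DifferentiableAt ℝ C (x t)) (p₀ : F →L[ℝ] ℝ)
    (hAC : ∀ η, A (x t) (C (x t) η) = η)
    (hinv : ∀ η, fderiv ℝ ℓ (x t, deriv x t) (C (x t) η, fderiv ℝ C (x t) (deriv x t) η) = 0)
    (lam : F →L[ℝ] ℝ)
    (heq : deriv (momentum ℓ x) t - (fderiv ℝ ℓ (x t, deriv x t)).comp
      (ContinuousLinearMap.inl ℝ E E) = lam.comp (A (x t))) (w : E) :
    deriv (correctedMomentum ℓ A C p₀ x) t w = fderiv ℝ ℓ (x t, deriv x t) (w, 0) +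
      (p₀ - (momentum ℓ x t).comp (C (x t))) (fderiv ℝ A (x t) (deriv x t) w) := by
  rw [(hasDerivAt_correctedMomentum hℓ hx hA hC p₀).deriv]
  have e1 := DFunLike.congr_fun heq w
  -- The equation is tested on `w` and on its vertical part C A w, which produce the same `lam (A
  -- w)`. Combined with invariance, the second is the momentum equation, and it cancels the
  -- multiplier in the first.
  have e2 := DFunLike.congr_fun heq (C (x t) (A (x t) w))
  have e3 := hinv (A (x t) w)
  have hs : ∀ y z : E, fderiv ℝ ℓ (x t, deriv x t) (y, z) =
      fderiv ℝ ℓ (x t, deriv x t) (y, 0) + fderiv ℝ ℓ (x t, deriv x t) (0, z) := by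
    intro y z
    rw [← map_add]; simp
  rw [hs] at e3
  simp only [_root_.sub_apply, ContinuousLinearMap.comp_apply,
    ContinuousLinearMap.inl_apply, hAC] at e1 e2
  simp only [_root_.add_apply, _root_.sub_apply,
    ContinuousLinearMap.comp_apply, _root_.zero_apply]
  have e4 : momentum ℓ x t (fderiv ℝ C (x t) (deriv x t) (A (x t) w)) =
    fderiv ℝ ℓ (x t, deriv x t) (0, fderiv ℝ C (x t) (deriv x t) (A (x t) w)) := rfl
  rw [e4]
  linarith

/-- The curvature vanishes on the vertical directions when the constraint is invariant. -/
theorem formCurvature_vertical {A : E → E →L[ℝ] F} {a : E → F} {C : E → F →L[ℝ] E} {x v : E}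
    (hA : DifferentiableAt ℝ A x) (ha : DifferentiableAt ℝ a x) (hC : DifferentiableAt ℝ C x)
    (hAC : ∀ᶠ y in 𝓝 x, ∀ η, A y (C y η) = η) {η : F}
    (hinv : fderiv ℝ (fun y : E × E => A y.1 y.2 - a y.1) (x, v) (C x η, fderiv ℝ C x v η) = 0) :
    formCurvature A a x v (C x η) = 0 := by
  rw [fderiv_affine_apply hA ha] at hinv
  -- Differentiating A C = 1 along `v` gives A(DC(v)η) + DA(v)(Cη) = 0; subtracting the
  -- infinitesimal invariance of A v − a leaves the curvature.
  have h1 := (hA.hasFDerivAt.clm_comp hC.hasFDerivAt)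
  have h2 : (fun y => (A y).comp (C y)) =ᶠ[𝓝 x] fun _ => ContinuousLinearMap.id ℝ F := by
    filter_upwards [hAC] with y hy
    ext ξ
    simp [hy]
  have h3 := h1.fderiv
  rw [h2.fderiv_eq] at h3
  have h4 := DFunLike.congr_fun (DFunLike.congr_fun h3 v) η
  simp at h4
  rw [formCurvature]
  have h5 : fderiv ℝ A x v (C x η) - fderiv ℝ A x (C x η) v + fderiv ℝ a x (C x η) =
      (A x (fderiv ℝ C x v η) + fderiv ℝ A x v (C x η)) -
        (A x (fderiv ℝ C x v η) + fderiv ℝ A x (C x η) v - fderiv ℝ a x (C x η)) := by abel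
  rw [h5, ← h4, hinv, sub_zero]

/-- The vakonomic equation along a nonholonomic solution with symmetry reduces to the vanishing of
the curvature, paired with the difference of the vertical momenta, on the horizontal directions. -/
theorem vakonomic_iff_formCurvature {ℓ : E × E → ℝ} {A : E → E →L[ℝ] F} {a : E → F}
    {C : E → F →L[ℝ] E} {x : ℝ → E} {t : ℝ}
    (hℓ : ContDiffAt ℝ 2 ℓ (x t, deriv x t)) (hx : ContDiffAt ℝ 2 x t)
    (hA : DifferentiableAt ℝ A (x t)) (ha : DifferentiableAt ℝ a (x t))
    (hC : DifferentiableAt ℝ C (x t)) (p₀ : F →L[ℝ] ℝ)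
    (hAC : ∀ᶠ y in 𝓝 (x t), ∀ η, A y (C y η) = η)
    (hinv : ∀ η, fderiv ℝ ℓ (x t, deriv x t) (C (x t) η, fderiv ℝ C (x t) (deriv x t) η) = 0)
    (hinv' : ∀ η, fderiv ℝ (fun y : E × E => A y.1 y.2 - a y.1) (x t, deriv x t)
      (C (x t) η, fderiv ℝ C (x t) (deriv x t) η) = 0)
    (lam : F →L[ℝ] ℝ)
    (heq : deriv (momentum ℓ x) t - (fderiv ℝ ℓ (x t, deriv x t)).comp
      (ContinuousLinearMap.inl ℝ E E) = lam.comp (A (x t))) :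
    (∀ y z : E, fderiv ℝ (fun y : E × E => A y.1 y.2 - a y.1) (x t, deriv x t) (y, z) = 0 →
      - deriv (correctedMomentum ℓ A C p₀ x) t y = correctedMomentum ℓ A C p₀ x t z -
        fderiv ℝ ℓ (x t, deriv x t) (y, z)) ↔
    ∀ w, A (x t) w = 0 → (p₀ - (momentum ℓ x t).comp (C (x t)))
      (formCurvature A a (x t) (deriv x t) w) = 0 := by
  have hAC' := hAC.self_of_nhds
  set μ := p₀ - (momentum ℓ x t).comp (C (x t)) with hμ
  have hs : ∀ y z : E, fderiv ℝ ℓ (x t, deriv x t) (y, z) =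
      fderiv ℝ ℓ (x t, deriv x t) (y, 0) + momentum ℓ x t z := by
    intro y z
    change _ = _ + fderiv ℝ ℓ (x t, deriv x t) (0, z)
    rw [← map_add]; simp
  have hp : ∀ z, correctedMomentum ℓ A C p₀ x t z = momentum ℓ x t z + μ (A (x t) z) :=
    fun z => rfl
  have hd : ∀ w, deriv (correctedMomentum ℓ A C p₀ x) t w =
      fderiv ℝ ℓ (x t, deriv x t) (w, 0) + μ (fderiv ℝ A (x t) (deriv x t) w) :=
    deriv_correctedMomentum_apply hℓ hx hA hC p₀ hAC' hinv lam heq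
  have hK : ∀ w, μ (formCurvature A a (x t) (deriv x t) w) =
      μ (fderiv ℝ A (x t) (deriv x t) w) - μ (fderiv ℝ A (x t) w (deriv x t)) +
        μ (fderiv ℝ a (x t) w) := by
    intro w; simp [formCurvature]
  constructor
  · intro h w _
    -- This `z` completes `w` to a vector (w, z) tangent to the constraint; it exists because C is a
    -- right inverse of A.
    obtain ⟨z, hz⟩ : ∃ z, A (x t) z = fderiv ℝ a (x t) w - fderiv ℝ A (x t) w (deriv x t) :=
      ⟨_, hAC' _⟩
    have h1 := h w z (by rw [fderiv_affine_apply hA ha, hz]; abel)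
    rw [hd, hs w z, hp, hz, map_sub] at h1
    rw [hK]
    linarith
  · intro h y z hyz
    rw [fderiv_affine_apply hA ha] at hyz
    -- The hypothesis is applied to the horizontal part of `y`; the vertical part contributes
    -- nothing to the curvature.
    have h1 := h (y - C (x t) (A (x t) y)) (by rw [map_sub, hAC', sub_self])
    have h2 := formCurvature_vertical hA ha hC hAC (hinv' (A (x t) y))
    have h3 : formCurvature A a (x t) (deriv x t) (y - C (x t) (A (x t) y)) =
        formCurvature A a (x t) (deriv x t) y -
          formCurvature A a (x t) (deriv x t) (C (x t) (A (x t) y)) := by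
      simp only [formCurvature, map_sub, _root_.sub_apply]; abel
    rw [h3, h2, sub_zero, hK] at h1
    have h4 := congrArg μ hyz
    rw [map_sub, map_add, map_zero] at h4
    rw [hd, hs y z, hp]
    linarith

end Calculus

/-! ### Charts of the maximal atlas and smoothness in tangent coordinates. -/

section Charts

variable {E Q V : Type*} [NormedAddCommGroup E] [NormedSpace ℝ E]
  [NormedAddCommGroup V] [NormedSpace ℝ V]
  [TopologicalSpace Q] [ChartedSpace E Q]

/-- Every tangent space is the model space by definition, so fibre components over propositionally
equal base points, such as `e.symm (e q)` and `q`, can be compared directly. -/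
theorem tangentBundle_mk_congr {q q' : Q} (h : q = q') {v w : E} (hvw : v = w) :
    (⟨q, v⟩ : TangentBundle 𝓘(ℝ, E) Q) = ⟨q', w⟩ := by
  subst h; subst hvw; rfl

theorem mfderiv_congr_base {f : Q → V} {q q' : Q} (h : q = q') (w : E) :
    (mfderiv 𝓘(ℝ, E) 𝓘(ℝ, V) f q : E →L[ℝ] V) w =
      (mfderiv 𝓘(ℝ, E) 𝓘(ℝ, V) f q' : E →L[ℝ] V) w := by
  subst h; rfl

theorem tangentMap_congr_of_eventuallyEq {E' Q' : Type*} [NormedAddCommGroup E']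
    [NormedSpace ℝ E'] [TopologicalSpace Q'] [ChartedSpace E' Q'] {f g : Q → Q'} {q : Q}
    (h : f =ᶠ[𝓝 q] g) (v : E) :
    tangentMap 𝓘(ℝ, E) 𝓘(ℝ, E') f ⟨q, v⟩ = tangentMap 𝓘(ℝ, E) 𝓘(ℝ, E') g ⟨q, v⟩ := by
  refine tangentBundle_mk_congr h.eq_of_nhds ?_
  exact congrArg (fun T : E →L[ℝ] E' => T v) h.mfderiv_eq

theorem mdifferentiable_of_mem_maximalAtlas {e : OpenPartialHomeomorph Q E}
    (he : e ∈ IsManifold.maximalAtlas 𝓘(ℝ, E) ∞ Q) :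
    e.MDifferentiable 𝓘(ℝ, E) 𝓘(ℝ, E) :=
  ⟨(contMDiffOn_of_mem_maximalAtlas he).mdifferentiableOn (by simp),
    (contMDiffOn_symm_of_mem_maximalAtlas he).mdifferentiableOn (by simp)⟩

/-- The differential of a coordinate system at `q`, as an automorphism of the model space. -/
noncomputable def chartDeriv {e : OpenPartialHomeomorph Q E}
    (he : e ∈ IsManifold.maximalAtlas 𝓘(ℝ, E) ∞ Q) {q : Q} (hq : q ∈ e.source) : E ≃L[ℝ] E :=
  (mdifferentiable_of_mem_maximalAtlas he).mfderiv hq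

theorem coe_chartDeriv {e : OpenPartialHomeomorph Q E}
    (he : e ∈ IsManifold.maximalAtlas 𝓘(ℝ, E) ∞ Q) {q : Q} (hq : q ∈ e.source) :
    (chartDeriv he hq : E →L[ℝ] E) = mfderiv 𝓘(ℝ, E) 𝓘(ℝ, E) e q := rfl

theorem coe_chartDeriv_symm {e : OpenPartialHomeomorph Q E}
    (he : e ∈ IsManifold.maximalAtlas 𝓘(ℝ, E) ∞ Q) {q : Q} (hq : q ∈ e.source) :
    ((chartDeriv he hq).symm : E →L[ℝ] E) = mfderiv 𝓘(ℝ, E) 𝓘(ℝ, E) e.symm (e q) := rfl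

theorem inverse_mfderiv_chart {e : OpenPartialHomeomorph Q E}
    (he : e ∈ IsManifold.maximalAtlas 𝓘(ℝ, E) ∞ Q) {q : Q} (hq : q ∈ e.source) :
    (mfderiv 𝓘(ℝ, E) 𝓘(ℝ, E) e q : E →L[ℝ] E).inverse =
      ((chartDeriv he hq).symm : E →L[ℝ] E) :=
  ContinuousLinearMap.inverse_equiv (chartDeriv he hq)

/-- Identifies pairs (x, ẋ) with tangent vectors of the model space, so that the tangent map of
`e.symm` can be applied to them smoothly. -/
theorem contMDiff_prod_tangentBundle :
    ContMDiff 𝓘(ℝ, E × E) 𝓘(ℝ, E).tangent ∞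
      (fun x : E × E => (⟨x.1, x.2⟩ : TangentBundle 𝓘(ℝ, E) E)) := by
  intro x
  rw [Bundle.contMDiffAt_totalSpace]
  refine ⟨contDiff_fst.contMDiff.contMDiffAt, ?_⟩
  refine (contDiff_snd (𝕜 := ℝ) (E := E) (F := E) (n := ∞)).contMDiff.contMDiffAt
    |>.congr_of_eventuallyEq ?_
  filter_upwards with y
  simp

variable [IsManifold 𝓘(ℝ, E) ∞ Q]

/-- A smooth function on `TQ` is smooth in the coordinates `(x, ẋ)`. -/
theorem contDiffOn_tangent_coordinates {φ : TangentBundle 𝓘(ℝ, E) Q → V}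
    (hφ : ContMDiff 𝓘(ℝ, E).tangent 𝓘(ℝ, V) ∞ φ) {e : OpenPartialHomeomorph Q E}
    (he : e ∈ IsManifold.maximalAtlas 𝓘(ℝ, E) ∞ Q) :
    ContDiffOn ℝ ∞ (fun x : E × E =>
      φ ⟨e.symm x.1, mfderiv 𝓘(ℝ, E) 𝓘(ℝ, E) e.symm x.1 x.2⟩) (e.target ×ˢ univ) := by
  rw [← contMDiffOn_iff_contDiffOn]
  have h1 := (contMDiffOn_symm_of_mem_maximalAtlas he).contMDiffOn_tangentMapWithin (m := ∞)
    (by simp) e.open_target.uniqueMDiffOn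
  have h2 := h1.comp (contMDiff_prod_tangentBundle.contMDiffOn (s := e.target ×ˢ univ))
    (fun x hx => hx.1)
  have h3 := hφ.comp_contMDiffOn h2
  refine h3.congr ?_
  rintro ⟨x, v⟩ hx
  change _ = φ ⟨e.symm x, mfderivWithin 𝓘(ℝ, E) 𝓘(ℝ, E) e.symm e.target x v⟩
  rw [mfderivWithin_of_isOpen e.open_target hx.1]

theorem contDiffAt_tangent_coordinates {φ : TangentBundle 𝓘(ℝ, E) Q → V}
    (hφ : ContMDiff 𝓘(ℝ, E).tangent 𝓘(ℝ, V) ∞ φ) {e : OpenPartialHomeomorph Q E}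
    (he : e ∈ IsManifold.maximalAtlas 𝓘(ℝ, E) ∞ Q) {x : E × E} (hx : x.1 ∈ e.target) :
    ContDiffAt ℝ ∞ (fun x : E × E =>
      φ ⟨e.symm x.1, mfderiv 𝓘(ℝ, E) 𝓘(ℝ, E) e.symm x.1 x.2⟩) x :=
  (contDiffOn_tangent_coordinates hφ he).contDiffAt
    ((e.open_target.prod isOpen_univ).mem_nhds ⟨hx, mem_univ _⟩)

end Charts

/-! ### Infinitesimal invariance under the group action. -/

section Symmetry

variable {F G : Type*} [NormedAddCommGroup F] [NormedSpace ℝ F]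
  [TopologicalSpace G] [ChartedSpace F G] [Group G]

/-- A straight line in the chart at 1 suffices: only the velocity at 0 matters later, and no
one-parameter subgroup is needed. -/
theorem exists_curve_one [IsManifold 𝓘(ℝ, F) ∞ G] (ξ : F) : ∃ c : ℝ → G,
    ContMDiffAt 𝓘(ℝ, ℝ) 𝓘(ℝ, F) ∞ c 0 ∧ c 0 = 1 ∧
      (mfderiv 𝓘(ℝ, ℝ) 𝓘(ℝ, F) c 0 : ℝ →L[ℝ] F) 1 = ξ := by
  let κ := extChartAt 𝓘(ℝ, F) (1 : G)
  let l : ℝ → F := fun s => κ 1 + s • ξ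
  have hl : ContDiff ℝ ∞ l := by fun_prop
  have hl0 : l 0 = κ 1 := by simp [l]
  have hκ : ContMDiffAt 𝓘(ℝ, F) 𝓘(ℝ, F) ∞ κ.symm (l 0) := by
    rw [hl0]
    exact (contMDiffOn_extChartAt_symm (1 : G)).contMDiffAt (extChartAt_target_mem_nhds 1)
  refine ⟨κ.symm ∘ l, ContMDiffAt.comp 0 hκ hl.contMDiff.contMDiffAt, ?_, ?_⟩
  · simp [hl0, κ]
  · have h1 : mfderiv 𝓘(ℝ, F) 𝓘(ℝ, F) κ.symm (κ 1) = ContinuousLinearMap.id ℝ F := by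
      have := mfderivWithin_range_extChartAt_symm (I := 𝓘(ℝ, F)) (x := (1 : G))
      simpa using! this
    rw [mfderiv_comp (I' := 𝓘(ℝ, F)) (0 : ℝ) (hκ.mdifferentiableAt (by simp))
      (hl.contMDiff.contMDiffAt.mdifferentiableAt (by simp))]
    have h2 : mfderiv 𝓘(ℝ, ℝ) 𝓘(ℝ, F) l 0 = fderiv ℝ l 0 := mfderiv_eq_fderiv
    have h3 : fderiv ℝ l 0 1 = ξ := by
      have : HasDerivAt l ξ 0 := by
        simpa [l] using ((hasDerivAt_id (0 : ℝ)).smul_const ξ).const_add (κ 1 : F)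
      rw [← this.deriv]; simp
    change (mfderiv 𝓘(ℝ, F) 𝓘(ℝ, F) κ.symm (l 0) : F →L[ℝ] F)
      ((mfderiv 𝓘(ℝ, ℝ) 𝓘(ℝ, F) l 0 : ℝ →L[ℝ] F) 1) = ξ
    have h4 : (mfderiv 𝓘(ℝ, ℝ) 𝓘(ℝ, F) l 0 : ℝ →L[ℝ] F) 1 = ξ :=
      (congrArg (fun T : ℝ →L[ℝ] F => T 1) h2).trans h3
    have h5 : (mfderiv 𝓘(ℝ, F) 𝓘(ℝ, F) κ.symm (l 0) : F →L[ℝ] F) = ContinuousLinearMap.id ℝ F := by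
      rw [hl0]; exact h1
    exact (congrArg _ h4).trans (congrArg (fun T : F →L[ℝ] F => T ξ) h5)

variable {B Q : Type*} [NormedAddCommGroup B] [NormedSpace ℝ B]
  [TopologicalSpace Q] [ChartedSpace (B × F) Q] [MulAction G Q]

/-- The infinitesimal generators in the coordinate system `e`. -/
noncomputable def localGenerator (e : OpenPartialHomeomorph Q (B × F)) (x : B × F) :
    F →L[ℝ] (B × F) :=
  (mfderiv 𝓘(ℝ, B × F) 𝓘(ℝ, B × F) e (e.symm x) : (B × F) →L[ℝ] (B × F)).comp
    (generator B F G Q (e.symm x))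

variable [ContMDiffSMul 𝓘(ℝ, F) 𝓘(ℝ, B × F) ∞ G Q]

/-- The map f(s, y) = e(c(s)·e⁻¹(y)) between vector spaces carries all that is needed of the action:
∂f/∂s at s = 0 is the generator, and ∂f/∂y is the tangent lift in coordinates. -/
theorem contDiffAt_chart_smul {e : OpenPartialHomeomorph Q (B × F)}
    (he : e ∈ IsManifold.maximalAtlas 𝓘(ℝ, B × F) ∞ Q) {c : ℝ → G}
    (hc : ContMDiffAt 𝓘(ℝ, ℝ) 𝓘(ℝ, F) ∞ c 0) (hc0 : c 0 = 1) {x : B × F} (hx : x ∈ e.target) :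
    ContDiffAt ℝ ∞ (fun y : ℝ × (B × F) => e (c y.1 • e.symm y.2)) (0, x) := by
  rw [← contMDiffAt_iff_contDiffAt]
  have h1 : ContMDiffAt 𝓘(ℝ, ℝ × (B × F)) 𝓘(ℝ, F) ∞ (fun y : ℝ × (B × F) => c y.1) (0, x) :=
    ContMDiffAt.comp (I' := 𝓘(ℝ, ℝ)) (0, x) (g := c) (f := Prod.fst) hc
      contDiff_fst.contMDiff.contMDiffAt
  have h2 : ContMDiffAt 𝓘(ℝ, ℝ × (B × F)) 𝓘(ℝ, B × F) ∞
      (fun y : ℝ × (B × F) => e.symm y.2) (0, x) :=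
    ContMDiffAt.comp (I' := 𝓘(ℝ, B × F)) (0, x) (g := e.symm) (f := Prod.snd)
      (contMDiffAt_symm_of_mem_maximalAtlas he hx)
      contDiff_snd.contMDiff.contMDiffAt
  have h3 : ContMDiffAt 𝓘(ℝ, ℝ × (B × F)) 𝓘(ℝ, B × F) ∞
      (fun y : ℝ × (B × F) => c y.1 • e.symm y.2) (0, x) := h1.smul h2
  refine ContMDiffAt.comp (I' := 𝓘(ℝ, B × F)) (0, x) (g := e) ?_ h3
  refine contMDiffAt_of_mem_maximalAtlas he ?_
  simp [hc0, e.map_target hx]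

theorem localGenerator_apply_eq {e : OpenPartialHomeomorph Q (B × F)}
    (he : e ∈ IsManifold.maximalAtlas 𝓘(ℝ, B × F) ∞ Q) {c : ℝ → G}
    (hc : ContMDiffAt 𝓘(ℝ, ℝ) 𝓘(ℝ, F) ∞ c 0) (hc0 : c 0 = 1) {x : B × F} (hx : x ∈ e.target) :
    localGenerator (G := G) e x ((mfderiv 𝓘(ℝ, ℝ) 𝓘(ℝ, F) c 0 : ℝ →L[ℝ] F) 1) =
      fderiv ℝ (fun y : ℝ × (B × F) => e (c y.1 • e.symm y.2)) (0, x) (1, 0) := by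
  have ho : MDifferentiableAt 𝓘(ℝ, F) 𝓘(ℝ, B × F) (fun g : G => g • e.symm x) (c 0) :=
    (contMDiff_id.smul contMDiff_const : ContMDiff 𝓘(ℝ, F) 𝓘(ℝ, B × F) ∞
      (fun g : G => g • e.symm x)).mdifferentiableAt (by simp)
  have hcd := hc.mdifferentiableAt (by simp)
  have hmem : c 0 • e.symm x ∈ e.source := by simp [hc0, e.map_target hx]
  have hed := (mdifferentiable_of_mem_maximalAtlas he).mdifferentiableAt hmem
  let T₁ : ℝ →L[ℝ] F := mfderiv 𝓘(ℝ, ℝ) 𝓘(ℝ, F) c 0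
  let T₂ : F →L[ℝ] (B × F) := mfderiv 𝓘(ℝ, F) 𝓘(ℝ, B × F) (fun g : G => g • e.symm x) (c 0)
  let T₃ : (B × F) →L[ℝ] (B × F) := mfderiv 𝓘(ℝ, B × F) 𝓘(ℝ, B × F) e (c 0 • e.symm x)
  have h1 := (hed.hasMFDerivAt.comp (c 0) ho.hasMFDerivAt).comp 0 hcd.hasMFDerivAt
  have h2' : HasFDerivAt (fun s => e (c s • e.symm x)) ((T₃.comp T₂).comp T₁) 0 := h1.hasFDerivAt
  have h2 := h2'.hasDerivAt
  have h3 : HasDerivAt (fun s => e (c s • e.symm x))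
      (fderiv ℝ (fun y : ℝ × (B × F) => e (c y.1 • e.symm y.2)) (0, x) (1, 0)) 0 := by
    have h4 : HasDerivAt (fun s : ℝ => (s, x)) ((1, 0) : ℝ × (B × F)) 0 :=
      (hasDerivAt_id 0).prodMk (hasDerivAt_const 0 x)
    exact ((contDiffAt_chart_smul he hc hc0 hx).differentiableAt
      (by simp)).hasFDerivAt.comp_hasDerivAt (0 : ℝ) h4
  -- Stated for an arbitrary g equal to 1, since `c 0 = 1` holds only propositionally and the base
  -- points of the differentials depend on g.
  have h5 : ∀ g : G, g = 1 → ∀ ξ : F, localGenerator (G := G) e x ξ =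
      (mfderiv 𝓘(ℝ, B × F) 𝓘(ℝ, B × F) e (g • e.symm x) : (B × F) →L[ℝ] (B × F))
        ((mfderiv 𝓘(ℝ, F) 𝓘(ℝ, B × F) (fun g : G => g • e.symm x) g : F →L[ℝ] (B × F)) ξ) := by
    rintro g rfl ξ
    exact mfderiv_congr_base (one_smul G (e.symm x)).symm _
  exact (h5 _ hc0 _).trans (h2.unique h3)

theorem contDiffAt_fderiv_chart_smul {e : OpenPartialHomeomorph Q (B × F)}
    (he : e ∈ IsManifold.maximalAtlas 𝓘(ℝ, B × F) ∞ Q) {c : ℝ → G}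
    (hc : ContMDiffAt 𝓘(ℝ, ℝ) 𝓘(ℝ, F) ∞ c 0) (hc0 : c 0 = 1) {x : B × F} (hx : x ∈ e.target) :
    ContDiffAt ℝ ∞ (fderiv ℝ fun y : ℝ × (B × F) => e (c y.1 • e.symm y.2)) (0, x) :=
  (contDiffAt_chart_smul he hc hc0 hx).fderiv_right (by simp)

/-- As F is finite-dimensional, smoothness may be tested on each ξ, where the generator is a partial
derivative of the smooth map f. -/
theorem contDiffOn_localGenerator [FiniteDimensional ℝ F] [IsManifold 𝓘(ℝ, F) ∞ G]
    {e : OpenPartialHomeomorph Q (B × F)}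
    (he : e ∈ IsManifold.maximalAtlas 𝓘(ℝ, B × F) ∞ Q) :
    ContDiffOn ℝ ∞ (localGenerator (G := G) e) e.target := by
  rw [contDiffOn_clm_apply]
  intro ξ
  obtain ⟨c, hc, hc0, hcξ⟩ := exists_curve_one (G := G) ξ
  have h : ContDiffOn ℝ ∞ (fun x => fderiv ℝ (fun y : ℝ × (B × F) => e (c y.1 • e.symm y.2))
      (0, x) (1, 0)) e.target := by
    intro x hx
    refine ContDiffAt.contDiffWithinAt ?_
    have h1 : ContDiffAt ℝ ∞ (fun x : B × F => ((0 : ℝ), x)) x := by fun_prop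
    exact (ContDiffAt.comp x (contDiffAt_fderiv_chart_smul he hc hc0 hx) h1).clm_apply
      contDiffAt_const
  refine h.congr fun x hx => ?_
  rw [← hcξ]
  exact localGenerator_apply_eq he hc hc0 hx

/-- The generator is ∂f/∂s at s = 0; interchanging the mixed partials makes its x-derivative the
s-derivative of the tangent lift. -/
theorem fderiv_localGenerator_apply [FiniteDimensional ℝ F] [IsManifold 𝓘(ℝ, F) ∞ G]
    {e : OpenPartialHomeomorph Q (B × F)}
    (he : e ∈ IsManifold.maximalAtlas 𝓘(ℝ, B × F) ∞ Q) {c : ℝ → G}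
    (hc : ContMDiffAt 𝓘(ℝ, ℝ) 𝓘(ℝ, F) ∞ c 0) (hc0 : c 0 = 1) {ξ : F}
    (hcξ : (mfderiv 𝓘(ℝ, ℝ) 𝓘(ℝ, F) c 0 : ℝ →L[ℝ] F) 1 = ξ) {x : B × F} (hx : x ∈ e.target)
    (v : B × F) :
    fderiv ℝ (localGenerator (G := G) e) x v ξ =
      fderiv ℝ (fderiv ℝ fun y : ℝ × (B × F) => e (c y.1 • e.symm y.2)) (0, x) (1, 0) (0, v) := by
  have hf := contDiffAt_chart_smul he hc hc0 hx
  rw [(hf.isSymmSndFDerivAt (by simpa using ENat.LEInfty.out)).eq (1, 0) (0, v)]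
  have hC : DifferentiableAt ℝ (localGenerator (G := G) e) x :=
    ((contDiffOn_localGenerator he).contDiffAt (e.open_target.mem_nhds hx)).differentiableAt
      (by simp)
  have h1 : HasFDerivAt (fun y => localGenerator (G := G) e y ξ) _ x :=
    hC.hasFDerivAt.clm_apply (hasFDerivAt_const ξ x)
  have h2 : HasFDerivAt (fun x : B × F => ((0 : ℝ), x)) (ContinuousLinearMap.inr ℝ ℝ (B × F)) x :=
    (ContinuousLinearMap.inr ℝ ℝ (B × F)).hasFDerivAt
  have h3 := (HasFDerivAt.comp x ((contDiffAt_fderiv_chart_smul he hc hc0 hx).differentiableAt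
    (by simp)).hasFDerivAt h2).clm_apply (hasFDerivAt_const ((1, 0) : ℝ × (B × F)) x)
  have h4 : (fun y => localGenerator (G := G) e y ξ) =ᶠ[𝓝 x] fun x =>
      fderiv ℝ (fun y : ℝ × (B × F) => e (c y.1 • e.symm y.2)) (0, x) (1, 0) := by
    filter_upwards [e.open_target.mem_nhds hx] with y hy
    rw [← hcξ]
    exact localGenerator_apply_eq he hc hc0 hy
  have h5 := DFunLike.congr_fun (h1.unique (h3.congr_of_eventuallyEq h4)) v
  simpa using h5

/-- The derivative of an invariant function along the tangent lift of an infinitesimal generator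
vanishes. -/
theorem fderiv_eq_zero_of_liftAction_invariant [FiniteDimensional ℝ F]
    [IsManifold 𝓘(ℝ, F) ∞ G] [IsManifold 𝓘(ℝ, B × F) ∞ Q]
    {V : Type*} [NormedAddCommGroup V] [NormedSpace ℝ V]
    {e : OpenPartialHomeomorph Q (B × F)}
    (he : e ∈ IsManifold.maximalAtlas 𝓘(ℝ, B × F) ∞ Q)
    {φ : TangentBundle 𝓘(ℝ, B × F) Q → V}
    (hφ : ContMDiff 𝓘(ℝ, B × F).tangent 𝓘(ℝ, V) ∞ φ) {x : B × F} (hx : x ∈ e.target) (v : B × F)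
    (hinv : ∀ g : G, φ (liftAction B F G Q g
      ⟨e.symm x, mfderiv 𝓘(ℝ, B × F) 𝓘(ℝ, B × F) e.symm x v⟩) =
        φ ⟨e.symm x, mfderiv 𝓘(ℝ, B × F) 𝓘(ℝ, B × F) e.symm x v⟩) (ξ : F) :
    fderiv ℝ (fun y : (B × F) × (B × F) =>
        φ ⟨e.symm y.1, mfderiv 𝓘(ℝ, B × F) 𝓘(ℝ, B × F) e.symm y.1 y.2⟩) (x, v)
      (localGenerator (G := G) e x ξ, fderiv ℝ (localGenerator (G := G) e) x v ξ) = 0 := by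
  obtain ⟨c, hc, hc0, hcξ⟩ := exists_curve_one (G := G) ξ
  set f : ℝ × (B × F) → B × F := fun y => e (c y.1 • e.symm y.2) with hf
  have hfd : ContDiffAt ℝ ∞ f (0, x) := contDiffAt_chart_smul he hc hc0 hx
  have hfe : ∀ᶠ y in 𝓝 (0, x), DifferentiableAt ℝ f y := by
    have h1 : ContDiffAt ℝ 1 f (0, x) := hfd.of_le (by simp)
    filter_upwards [h1.eventually (by simp)] with y hy using hy.differentiableAt (by simp)
  have hs : HasDerivAt (fun s : ℝ => (s, x)) ((1, 0) : ℝ × (B × F)) 0 :=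
    (hasDerivAt_id 0).prodMk (hasDerivAt_const 0 x)
  have hsc : Tendsto (fun s : ℝ => (s, x)) (𝓝 0) (𝓝 (0, x)) := hs.continuousAt
  have hf0 : ∀ y ∈ e.target, f (0, y) = y := by
    intro y hy
    simp [hf, hc0, hy]
  have hfx : fderiv ℝ f (0, x) (0, v) = v := by
    have h1 : HasFDerivAt (fun y : B × F => ((0 : ℝ), y))
        (ContinuousLinearMap.inr ℝ ℝ (B × F)) x :=
      (ContinuousLinearMap.inr ℝ ℝ (B × F)).hasFDerivAt
    have h2 := HasFDerivAt.comp x (hfd.differentiableAt (by simp)).hasFDerivAt h1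
    have h3 : (f ∘ fun y : B × F => ((0 : ℝ), y)) =ᶠ[𝓝 x] id := by
      filter_upwards [e.open_target.mem_nhds hx] with y hy using hf0 y hy
    have h4 := DFunLike.congr_fun (h2.unique ((hasFDerivAt_id x).congr_of_eventuallyEq h3)) v
    simpa using h4
  -- The orbit of the tangent vector under the lifted action, in coordinates: its velocity at s = 0
  -- is the tangent lift of the generator.
  have hh : HasDerivAt (fun s : ℝ => (f (s, x), fderiv ℝ f (s, x) (0, v)))
      (localGenerator (G := G) e x ξ, fderiv ℝ (localGenerator (G := G) e) x v ξ) 0 := by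
    refine HasDerivAt.prodMk ?_ ?_
    · have h1 := (hfd.differentiableAt (by simp)).hasFDerivAt.comp_hasDerivAt (0 : ℝ) hs
      have h2 : localGenerator (G := G) e x ξ = fderiv ℝ f (0, x) (1, 0) := by
        rw [← hcξ]
        exact localGenerator_apply_eq he hc hc0 hx
      rw [h2]
      exact h1
    · have h1 := ((contDiffAt_fderiv_chart_smul he hc hc0 hx).differentiableAt
        (by simp)).hasFDerivAt.comp_hasDerivAt (0 : ℝ) hs
      have h2 := h1.clm_apply (hasDerivAt_const (0 : ℝ) ((0, v) : ℝ × (B × F)))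
      rw [fderiv_localGenerator_apply he hc hc0 hcξ hx v]
      simpa using h2
  have hφd := (contDiffAt_tangent_coordinates hφ he (x := (x, v)) hx).differentiableAt (by simp)
  have hbase : (f (0, x), fderiv ℝ f (0, x) (0, v)) = (x, v) := by rw [hf0 x hx, hfx]
  have h1 := HasFDerivAt.comp_hasDerivAt_of_eq (0 : ℝ) hφd.hasFDerivAt hh hbase.symm
  have hmem : ∀ᶠ s in 𝓝 (0 : ℝ), c s • e.symm x ∈ e.source := by
    have hcont : ContinuousAt (fun s => c s • e.symm x) 0 :=
      (hc.smul contMDiffAt_const : ContMDiffAt 𝓘(ℝ, ℝ) 𝓘(ℝ, B × F) ∞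
        (fun s => c s • e.symm x) 0).continuousAt
    refine hcont.eventually_mem (e.open_source.mem_nhds ?_)
    simp [hc0, e.map_target hx]
  have h2 : ((fun y : (B × F) × (B × F) =>
        φ ⟨e.symm y.1, mfderiv 𝓘(ℝ, B × F) 𝓘(ℝ, B × F) e.symm y.1 y.2⟩) ∘
      fun s : ℝ => (f (s, x), fderiv ℝ f (s, x) (0, v))) =ᶠ[𝓝 0] fun _ =>
        φ ⟨e.symm x, mfderiv 𝓘(ℝ, B × F) 𝓘(ℝ, B × F) e.symm x v⟩ := by
    filter_upwards [hmem, hsc.eventually hfe] with s hs1 hs2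
    rw [← hinv (c s)]
    refine congrArg φ ?_
    have hcs : ContMDiff 𝓘(ℝ, B × F) 𝓘(ℝ, F) ∞ (fun _ : Q => c s) := contMDiff_const
    have ht : MDifferentiableAt 𝓘(ℝ, B × F) 𝓘(ℝ, B × F) (fun q : Q => c s • q) (e.symm x) :=
      (hcs.smul contMDiff_id : ContMDiff 𝓘(ℝ, B × F) 𝓘(ℝ, B × F) ∞
        (fun q : Q => c s • q)).mdifferentiableAt (by simp)
    have hes := (mdifferentiable_of_mem_maximalAtlas he).mdifferentiableAt_symm hx
    have hf1 : HasFDerivAt (fun y : B × F => f (s, y))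
        ((fderiv ℝ f (s, x)).comp (ContinuousLinearMap.inr ℝ ℝ (B × F))) x :=
      HasFDerivAt.comp x hs2.hasFDerivAt (hasFDerivAt_prodMk_right s x)
    have hf2 : fderiv ℝ f (s, x) (0, v) =
        (mfderiv 𝓘(ℝ, B × F) 𝓘(ℝ, B × F) (fun y : B × F => f (s, y)) x :
          (B × F) →L[ℝ] (B × F)) v :=
      (congrArg (fun T : (B × F) →L[ℝ] (B × F) => T v)
        (mfderiv_eq_fderiv.trans hf1.fderiv)).symm
    have hfm : f (s, x) ∈ e.target := e.map_source hs1
    -- Near x, `e.symm` of f(s, ·) is the action of c(s) after `e.symm`; applying the tangent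
    -- functor to both sides shows that the coordinate curve represents the lifted action.
    have hev : (e.symm ∘ fun y : B × F => f (s, y)) =ᶠ[𝓝 x]
        ((fun q : Q => c s • q) ∘ e.symm) := by
      have := (ht.continuousAt.comp hes.continuousAt).eventually_mem
        (e.open_source.mem_nhds hs1)
      filter_upwards [this] with y hy using e.left_inv hy
    have hl := tangentMap_congr_of_eventuallyEq (E' := B × F) hev v
    have hl1 := tangentMap_comp_at (I := 𝓘(ℝ, B × F)) (I' := 𝓘(ℝ, B × F)) (I'' := 𝓘(ℝ, B × F))
      (⟨x, v⟩ : TangentBundle 𝓘(ℝ, B × F) (B × F))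
      ((mdifferentiable_of_mem_maximalAtlas he).mdifferentiableAt_symm hfm)
      hf1.differentiableAt.mdifferentiableAt
    have hl2 := tangentMap_comp_at (I := 𝓘(ℝ, B × F)) (I' := 𝓘(ℝ, B × F)) (I'' := 𝓘(ℝ, B × F))
      (⟨x, v⟩ : TangentBundle 𝓘(ℝ, B × F) (B × F)) ht hes
    rw [hl1, hl2] at hl
    refine Eq.trans ?_ hl
    exact tangentBundle_mk_congr rfl (congrArg _ hf2)
  have h3 := h1.congr_of_eventuallyEq h2.symm
  exact h3.unique (hasDerivAt_const _ _)

end Symmetry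

/-! ### Coordinate expressions of the connection, the drift and the momenta. -/

section LocalExpressions

variable {B F G : Type*}
  [NormedAddCommGroup B] [NormedSpace ℝ B] [NormedAddCommGroup F] [NormedSpace ℝ F]
  [TopologicalSpace G] [ChartedSpace F G] [Group G]
  {Q : Type*} [TopologicalSpace Q] [ChartedSpace (B × F) Q]

theorem mfderiv_comp_congr {f : B × F → Q} {x y : B × F} (h : y = x)
    (T : (B × F) →L[ℝ] (B × F)) {S : (B × F) →L[ℝ] (B × F)}
    (hy : (mfderiv 𝓘(ℝ, B × F) 𝓘(ℝ, B × F) f y : (B × F) →L[ℝ] (B × F)).comp T = S) :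
    (mfderiv 𝓘(ℝ, B × F) 𝓘(ℝ, B × F) f x : (B × F) →L[ℝ] (B × F)).comp T = S := by
  subst h; exact hy

theorem mfderiv_symm_comp_mfderiv {e : OpenPartialHomeomorph Q (B × F)}
    (he : e ∈ IsManifold.maximalAtlas 𝓘(ℝ, B × F) ∞ Q) {x : B × F} (hx : x ∈ e.target) :
    (mfderiv 𝓘(ℝ, B × F) 𝓘(ℝ, B × F) e.symm x : (B × F) →L[ℝ] (B × F)).comp
      (mfderiv 𝓘(ℝ, B × F) 𝓘(ℝ, B × F) e (e.symm x) : (B × F) →L[ℝ] (B × F)) =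
      ContinuousLinearMap.id ℝ (B × F) :=
  mfderiv_comp_congr (e.right_inv hx) _
    ((mdifferentiable_of_mem_maximalAtlas he).symm.comp_symm_deriv (e.map_target hx))

theorem localCovector_eq {e : OpenPartialHomeomorph Q (B × F)}
    (he : e ∈ IsManifold.maximalAtlas 𝓘(ℝ, B × F) ∞ Q) {q : Q} (hq : q ∈ e.source)
    (p : TangentSpace 𝓘(ℝ, B × F) q →L[ℝ] ℝ) :
    localCovector e q p = (p : (B × F) →L[ℝ] ℝ).comp
      ((chartDeriv he hq).symm : (B × F) →L[ℝ] (B × F)) :=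
  congrArg (fun T : (B × F) →L[ℝ] (B × F) => (p : (B × F) →L[ℝ] ℝ).comp T)
    (inverse_mfderiv_chart he hq)

variable [MulAction G Q]

theorem localGenerator_chart {e : OpenPartialHomeomorph Q (B × F)}
    (he : e ∈ IsManifold.maximalAtlas 𝓘(ℝ, B × F) ∞ Q) {q : Q} (hq : q ∈ e.source) :
    localGenerator (G := G) e (e q) = (chartDeriv he hq : (B × F) →L[ℝ] (B × F)).comp
      (generator B F G Q q) := by
  rw [localGenerator, e.left_inv hq, coe_chartDeriv]
  rfl

variable [IsManifold 𝓘(ℝ, B × F) ∞ Q]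

/-- The connection form at `q` as a map between the model spaces. -/
noncomputable def modelForm (γ : PrincipalConnection B F G Q) (q : Q) : (B × F) →L[ℝ] F :=
  γ.form q

theorem contMDiff_modelForm (γ : PrincipalConnection B F G Q) :
    ContMDiff 𝓘(ℝ, B × F).tangent 𝓘(ℝ, F) ∞
      (fun v : TangentBundle 𝓘(ℝ, B × F) Q => modelForm γ v.proj v.2) := γ.smooth

/-- The connection form in the coordinate system `e`. -/
noncomputable def localForm (γ : PrincipalConnection B F G Q)
    (e : OpenPartialHomeomorph Q (B × F)) (x : B × F) : (B × F) →L[ℝ] F :=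
  (modelForm γ (e.symm x)).comp
    (mfderiv 𝓘(ℝ, B × F) 𝓘(ℝ, B × F) e.symm x : (B × F) →L[ℝ] (B × F))

/-- The function `γ(Z)` in the coordinate system `e`. -/
noncomputable def localDrift (γ : PrincipalConnection B F G Q)
    (Z : ∀ q : Q, TangentSpace 𝓘(ℝ, B × F) q)
    (e : OpenPartialHomeomorph Q (B × F)) (x : B × F) : F :=
  modelForm γ (e.symm x) (Z (e.symm x))

theorem localConstraint_eq (γ : PrincipalConnection B F G Q)
    (Z : ∀ q : Q, TangentSpace 𝓘(ℝ, B × F) q) (e : OpenPartialHomeomorph Q (B × F)) :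
    localConstraint γ Z e = fun x => localForm γ e x.1 x.2 - localDrift γ Z e x.1 := by
  funext x
  exact map_sub (modelForm γ (e.symm x.1)) _ _

theorem contDiffOn_localForm [FiniteDimensional ℝ B] [FiniteDimensional ℝ F]
    (γ : PrincipalConnection B F G Q) {e : OpenPartialHomeomorph Q (B × F)}
    (he : e ∈ IsManifold.maximalAtlas 𝓘(ℝ, B × F) ∞ Q) :
    ContDiffOn ℝ ∞ (localForm γ e) e.target := by
  rw [contDiffOn_clm_apply]
  intro w
  exact (contDiffOn_tangent_coordinates (contMDiff_modelForm γ) he).comp (f := fun x => (x, w))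
    (by fun_prop) (fun x hx => ⟨hx, mem_univ _⟩)

theorem contMDiff_form_vectorField (γ : PrincipalConnection B F G Q)
    {Z : ∀ q : Q, TangentSpace 𝓘(ℝ, B × F) q}
    (hZ : ContMDiff 𝓘(ℝ, B × F) 𝓘(ℝ, B × F).tangent ∞
      (fun q : Q => (⟨q, Z q⟩ : TangentBundle 𝓘(ℝ, B × F) Q))) :
    ContMDiff 𝓘(ℝ, B × F) 𝓘(ℝ, F) ∞ (fun q : Q => modelForm γ q (Z q)) :=
  (contMDiff_modelForm γ).comp hZ

theorem contMDiff_constraint (γ : PrincipalConnection B F G Q)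
    {Z : ∀ q : Q, TangentSpace 𝓘(ℝ, B × F) q}
    (hZ : ContMDiff 𝓘(ℝ, B × F) 𝓘(ℝ, B × F).tangent ∞
      (fun q : Q => (⟨q, Z q⟩ : TangentBundle 𝓘(ℝ, B × F) Q))) :
    ContMDiff 𝓘(ℝ, B × F).tangent 𝓘(ℝ, F) ∞ (fun v : TangentBundle 𝓘(ℝ, B × F) Q =>
      modelForm γ v.proj (v.2 - Z v.proj)) := by
  have h1 : ContMDiff 𝓘(ℝ, B × F).tangent 𝓘(ℝ, F) ∞ (fun v : TangentBundle 𝓘(ℝ, B × F) Q =>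
      modelForm γ v.proj (Z v.proj)) :=
    (contMDiff_form_vectorField γ hZ).comp
      (Bundle.contMDiff_proj (TangentSpace 𝓘(ℝ, B × F) : Q → Type _))
  have h2 : ContMDiff 𝓘(ℝ, B × F).tangent 𝓘(ℝ, F) ∞ (fun v : TangentBundle 𝓘(ℝ, B × F) Q =>
      modelForm γ v.proj v.2) := (contMDiff_modelForm γ)
  refine (h2.sub h1).congr fun v => ?_
  exact map_sub (modelForm γ v.proj) _ _

theorem contDiffOn_localDrift (γ : PrincipalConnection B F G Q)
    {Z : ∀ q : Q, TangentSpace 𝓘(ℝ, B × F) q}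
    (hZ : ContMDiff 𝓘(ℝ, B × F) 𝓘(ℝ, B × F).tangent ∞
      (fun q : Q => (⟨q, Z q⟩ : TangentBundle 𝓘(ℝ, B × F) Q)))
    {e : OpenPartialHomeomorph Q (B × F)}
    (he : e ∈ IsManifold.maximalAtlas 𝓘(ℝ, B × F) ∞ Q) :
    ContDiffOn ℝ ∞ (localDrift γ Z e) e.target := by
  rw [← contMDiffOn_iff_contDiffOn]
  exact (contMDiff_form_vectorField γ hZ).comp_contMDiffOn (contMDiffOn_symm_of_mem_maximalAtlas he)

/-- The chart differentials cancel, and γ reproduces generators; this is the identity A C = 1. -/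
theorem localForm_localGenerator (γ : PrincipalConnection B F G Q)
    {e : OpenPartialHomeomorph Q (B × F)}
    (he : e ∈ IsManifold.maximalAtlas 𝓘(ℝ, B × F) ∞ Q) {x : B × F} (hx : x ∈ e.target) (η : F) :
    localForm γ e x (localGenerator (G := G) e x η) = η := by
  have h := DFunLike.congr_fun (mfderiv_symm_comp_mfderiv he hx)
    ((generator B F G Q (e.symm x) : F →L[ℝ] (B × F)) η)
  exact (congrArg (modelForm γ (e.symm x)) h).trans (γ.form_generator _ η)

theorem localForm_chart (γ : PrincipalConnection B F G Q)
    {e : OpenPartialHomeomorph Q (B × F)}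
    (he : e ∈ IsManifold.maximalAtlas 𝓘(ℝ, B × F) ∞ Q) {q : Q} (hq : q ∈ e.source) :
    localForm γ e (e q) = (modelForm γ q).comp
      ((chartDeriv he hq).symm : (B × F) →L[ℝ] (B × F)) := by
  rw [localForm, e.left_inv hq, coe_chartDeriv_symm]

theorem localDrift_chart (γ : PrincipalConnection B F G Q)
    (Z : ∀ q : Q, TangentSpace 𝓘(ℝ, B × F) q)
    {e : OpenPartialHomeomorph Q (B × F)} {q : Q} (hq : q ∈ e.source) :
    localDrift γ Z e (e q) = modelForm γ q (Z q) := by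
  rw [localDrift, e.left_inv hq]

theorem contDiffAt_localLagrangian {L : TangentBundle 𝓘(ℝ, B × F) Q → ℝ}
    (hL : ContMDiff 𝓘(ℝ, B × F).tangent 𝓘(ℝ, ℝ) ∞ L) {e : OpenPartialHomeomorph Q (B × F)}
    (he : e ∈ IsManifold.maximalAtlas 𝓘(ℝ, B × F) ∞ Q) {x : (B × F) × (B × F)}
    (hx : x.1 ∈ e.target) : ContDiffAt ℝ ∞ (localLagrangian L e) x :=
  contDiffAt_tangent_coordinates hL he hx

/-- The fibre derivative in coordinates is `∂L/∂ẋ`. -/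
theorem localCovector_fiberDeriv {L : TangentBundle 𝓘(ℝ, B × F) Q → ℝ}
    (hL : ContMDiff 𝓘(ℝ, B × F).tangent 𝓘(ℝ, ℝ) ∞ L) {e : OpenPartialHomeomorph Q (B × F)}
    (he : e ∈ IsManifold.maximalAtlas 𝓘(ℝ, B × F) ∞ Q) (v : TangentBundle 𝓘(ℝ, B × F) Q)
    (hq : v.proj ∈ e.source) :
    localCovector e v.proj (fiberDeriv L v) =
      (fderiv ℝ (localLagrangian L e) (e v.proj, localVector e v)).comp
        (ContinuousLinearMap.inr ℝ (B × F) (B × F)) := by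
  obtain ⟨q, v⟩ := v
  rw [localCovector_eq he hq]
  let T := chartDeriv he hq
  have h1 : HasFDerivAt (fun w : B × F => localLagrangian L e (e q, w))
      ((fderiv ℝ (localLagrangian L e) (e q, T v)).comp
        (ContinuousLinearMap.inr ℝ (B × F) (B × F))) (T v) :=
    HasFDerivAt.comp (T v) ((contDiffAt_localLagrangian hL he
      (e.map_source hq)).differentiableAt (by simp)).hasFDerivAt (hasFDerivAt_prodMk_right _ _)
  have h2 : (fun w : B × F => localLagrangian L e (e q, w)) =
      (fun w : B × F => L ⟨q, w⟩) ∘ T.symm := by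
    funext w
    exact congrArg L (tangentBundle_mk_congr (e.left_inv hq) rfl)
  have h3 := h1.fderiv
  rw [h2, T.symm.comp_right_fderiv] at h3
  have h4 := T.symm_apply_apply v
  exact (congrArg (fun w : B × F => (fderiv ℝ (fun w : B × F => L ⟨q, w⟩) w).comp
    (T.symm : (B × F) →L[ℝ] (B × F))) h4).symm.trans h3

/-- The chart differential and its inverse cancel in the pairing of momentum with generators, so the
defining formula keeps its shape in coordinates. This is what matches it with `correctedMomentum`.
-/
theorem localCovector_covectorW₁ {L : TangentBundle 𝓘(ℝ, B × F) Q → ℝ}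
    (γ : PrincipalConnection B F G Q) {e : OpenPartialHomeomorph Q (B × F)}
    (he : e ∈ IsManifold.maximalAtlas 𝓘(ℝ, B × F) ∞ Q) (p₀ : F →L[ℝ] ℝ)
    (v : TangentBundle 𝓘(ℝ, B × F) Q) (hq : v.proj ∈ e.source) :
    localCovector e v.proj (covectorW₁ γ L p₀ v) = localCovector e v.proj (fiberDeriv L v) +
      (p₀ - (localCovector e v.proj (fiberDeriv L v)).comp
        (localGenerator (G := G) e (e v.proj))).comp (localForm γ e (e v.proj)) := by
  have h : ∀ (π : (B × F) →L[ℝ] ℝ) (g : F →L[ℝ] (B × F)) (A : (B × F) →L[ℝ] F)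
      (D : (B × F) ≃L[ℝ] (B × F)),
      (π + (p₀ - π.comp g).comp A).comp (D.symm : (B × F) →L[ℝ] (B × F)) =
        π.comp (D.symm : (B × F) →L[ℝ] (B × F)) +
        (p₀ - (π.comp (D.symm : (B × F) →L[ℝ] (B × F))).comp
          ((D : (B × F) →L[ℝ] (B × F)).comp g)).comp
            (A.comp (D.symm : (B × F) →L[ℝ] (B × F))) := by
    intro π g A D
    ext w <;> simp
  rw [localCovector_eq he hq, localCovector_eq he hq, localGenerator_chart he hq,
    localForm_chart γ he hq]
  exact h _ _ _ _

end LocalExpressions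

/-! ### The curvature condition: chart independence and equivalence with the vakonomic equation. -/

section CurvatureCondition

variable {B F G : Type*}
  [NormedAddCommGroup B] [NormedSpace ℝ B] [NormedAddCommGroup F] [NormedSpace ℝ F]
  [TopologicalSpace G] [ChartedSpace F G] [Group G]
  {Q : Type*} [TopologicalSpace Q] [ChartedSpace (B × F) Q] [MulAction G Q]

/-- The differential of a coordinate change. -/
theorem fderiv_coordinateChange {e e' : OpenPartialHomeomorph Q (B × F)}
    (he : e ∈ IsManifold.maximalAtlas 𝓘(ℝ, B × F) ∞ Q)
    (he' : e' ∈ IsManifold.maximalAtlas 𝓘(ℝ, B × F) ∞ Q) {q : Q} (hq : q ∈ e.source)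
    (hq' : q ∈ e'.source) :
    fderiv ℝ (e' ∘ e.symm) (e q) = (chartDeriv he' hq' : (B × F) →L[ℝ] (B × F)).comp
      ((chartDeriv he hq).symm : (B × F) →L[ℝ] (B × F)) := by
  have h1 : HasMFDerivAt 𝓘(ℝ, B × F) 𝓘(ℝ, B × F) e.symm (e q)
      ((chartDeriv he hq).symm : (B × F) →L[ℝ] (B × F)) :=
    ((mdifferentiable_of_mem_maximalAtlas he).mdifferentiableAt_symm
      (e.map_source hq)).hasMFDerivAt
  have h2 : HasMFDerivAt 𝓘(ℝ, B × F) 𝓘(ℝ, B × F) e' (e.symm (e q))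
      (chartDeriv he' hq' : (B × F) →L[ℝ] (B × F)) := by
    rw [e.left_inv hq]
    exact ((mdifferentiable_of_mem_maximalAtlas he').mdifferentiableAt hq').hasMFDerivAt
  have h3 := HasMFDerivAt.comp (e q) h2 h1
  have h4 : HasFDerivAt (e' ∘ e.symm) ((chartDeriv he' hq' : (B × F) →L[ℝ] (B × F)).comp
      ((chartDeriv he hq).symm : (B × F) →L[ℝ] (B × F))) (e q) := h3.hasFDerivAt
  exact h4.fderiv

theorem contDiffAt_coordinateChange {e e' : OpenPartialHomeomorph Q (B × F)}
    (he : e ∈ IsManifold.maximalAtlas 𝓘(ℝ, B × F) ∞ Q)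
    (he' : e' ∈ IsManifold.maximalAtlas 𝓘(ℝ, B × F) ∞ Q) {q : Q} (hq : q ∈ e.source)
    (hq' : q ∈ e'.source) : ContDiffAt ℝ ∞ (e' ∘ e.symm) (e q) := by
  rw [← contMDiffAt_iff_contDiffAt]
  refine ContMDiffAt.comp (I' := 𝓘(ℝ, B × F)) (e q) (contMDiffAt_of_mem_maximalAtlas he' ?_)
    (contMDiffAt_symm_of_mem_maximalAtlas he (e.map_source hq))
  rwa [e.left_inv hq]

/-- The infinitesimal generators at `q` as a map between the model spaces. -/
noncomputable def modelGenerator (G : Type*) [TopologicalSpace G] [ChartedSpace F G] [Group G]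
    [MulAction G Q] (q : Q) : F →L[ℝ] (B × F) :=
  generator B F G Q q

/-- The difference between `p₀` and the momentum of the group action at `v`. -/
noncomputable def momentumDefect (G : Type*) [TopologicalSpace G] [ChartedSpace F G] [Group G]
    [MulAction G Q] (L : TangentBundle 𝓘(ℝ, B × F) Q → ℝ) (p₀ : F →L[ℝ] ℝ)
    (v : TangentBundle 𝓘(ℝ, B × F) Q) : F →L[ℝ] ℝ :=
  p₀ - (fiberDeriv L v : (B × F) →L[ℝ] ℝ).comp (modelGenerator G v.proj)

theorem localCovector_comp_localGenerator (L : TangentBundle 𝓘(ℝ, B × F) Q → ℝ)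
    {e : OpenPartialHomeomorph Q (B × F)}
    (he : e ∈ IsManifold.maximalAtlas 𝓘(ℝ, B × F) ∞ Q) (p₀ : F →L[ℝ] ℝ)
    (v : TangentBundle 𝓘(ℝ, B × F) Q) (hq : v.proj ∈ e.source) :
    p₀ - (localCovector e v.proj (fiberDeriv L v)).comp
      (localGenerator (G := G) e (e v.proj)) = momentumDefect G L p₀ v := by
  have h : ∀ (π : (B × F) →L[ℝ] ℝ) (g : F →L[ℝ] (B × F)) (D : (B × F) ≃L[ℝ] (B × F)),
      p₀ - (π.comp (D.symm : (B × F) →L[ℝ] (B × F))).comp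
          ((D : (B × F) →L[ℝ] (B × F)).comp g) = p₀ - π.comp g := by
    intro π g D
    ext w
    simp
  rw [localCovector_eq he hq, localGenerator_chart he hq]
  exact h _ _ _

variable [IsManifold 𝓘(ℝ, B × F) ∞ Q]

/-- The curvature of the constraint along `v`, paired with the momentum defect, vanishes on the
horizontal vectors; expressed in the coordinate system `e`. -/
def CurvatureCondition (γ : PrincipalConnection B F G Q)
    (Z : ∀ q : Q, TangentSpace 𝓘(ℝ, B × F) q) (L : TangentBundle 𝓘(ℝ, B × F) Q → ℝ)
    (p₀ : F →L[ℝ] ℝ) (v : TangentBundle 𝓘(ℝ, B × F) Q)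
    (e : OpenPartialHomeomorph Q (B × F)) : Prop :=
  ∀ w : B × F, localForm γ e (e v.proj) w = 0 → momentumDefect G L p₀ v
    (formCurvature (localForm γ e) (localDrift γ Z e) (e v.proj) (localVector e v) w) = 0

/-- The local form and drift pull back under the transition map, so `formCurvature_comp` applies;
the momentum defect does not involve the chart. -/
theorem CurvatureCondition.coordinateChange [FiniteDimensional ℝ B] [FiniteDimensional ℝ F]
    {γ : PrincipalConnection B F G Q}
    {Z : ∀ q : Q, TangentSpace 𝓘(ℝ, B × F) q} {L : TangentBundle 𝓘(ℝ, B × F) Q → ℝ}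
    (hZ : ContMDiff 𝓘(ℝ, B × F) 𝓘(ℝ, B × F).tangent ∞
      (fun q : Q => (⟨q, Z q⟩ : TangentBundle 𝓘(ℝ, B × F) Q)))
    {p₀ : F →L[ℝ] ℝ} {v : TangentBundle 𝓘(ℝ, B × F) Q}
    {e e' : OpenPartialHomeomorph Q (B × F)}
    (he : e ∈ IsManifold.maximalAtlas 𝓘(ℝ, B × F) ∞ Q)
    (he' : e' ∈ IsManifold.maximalAtlas 𝓘(ℝ, B × F) ∞ Q) (hq : v.proj ∈ e.source)
    (hq' : v.proj ∈ e'.source) (h : CurvatureCondition γ Z L p₀ v e') :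
    CurvatureCondition γ Z L p₀ v e := by
  obtain ⟨q, v⟩ := v
  have hx' := e'.map_source hq'
  have hφq : (e' ∘ e.symm) (e q) = e' q := by simp only [Function.comp, e.left_inv hq]
  have hev : ∀ᶠ y in 𝓝 (e q), y ∈ e.target ∧ e.symm y ∈ e'.source := by
    refine (e.open_target.eventually_mem (e.map_source hq)).and ?_
    refine (e.continuousAt_symm (e.map_source hq)).eventually_mem (e'.open_source.mem_nhds ?_)
    rwa [e.left_inv hq]
  have hA : localForm γ e =ᶠ[𝓝 (e q)] fun y => (localForm γ e' ((e' ∘ e.symm) y)).comp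
      (fderiv ℝ (e' ∘ e.symm) y) := by
    filter_upwards [hev] with y hy
    have h1 := fderiv_coordinateChange he he' (e.map_target hy.1) hy.2
    have h2 := localForm_chart γ he (e.map_target hy.1)
    rw [e.right_inv hy.1] at h1 h2
    rw [h1, h2]
    change _ = (localForm γ e' (e' (e.symm y))).comp _
    rw [localForm_chart γ he' hy.2]
    ext w <;> simp
  have ha : localDrift γ Z e =ᶠ[𝓝 (e q)] fun y => localDrift γ Z e' ((e' ∘ e.symm) y) := by
    filter_upwards [hev] with y hy
    have h2 := localDrift_chart γ Z (e.map_target hy.1)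
    rw [e.right_inv hy.1] at h2
    rw [h2]
    exact (localDrift_chart γ Z hy.2).symm
  have hA' : DifferentiableAt ℝ (localForm γ e') ((e' ∘ e.symm) (e q)) := by
    rw [hφq]
    exact ((contDiffOn_localForm γ he').contDiffAt (e'.open_target.mem_nhds hx')).differentiableAt
      (by simp)
  have ha' : DifferentiableAt ℝ (localDrift γ Z e') ((e' ∘ e.symm) (e q)) := by
    rw [hφq]
    exact ((contDiffOn_localDrift γ hZ he').contDiffAt
      (e'.open_target.mem_nhds hx')).differentiableAt (by simp)
  have hvec : fderiv ℝ (e' ∘ e.symm) (e q) (localVector e ⟨q, v⟩) = localVector e' ⟨q, v⟩ := by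
    rw [fderiv_coordinateChange he he' hq hq']
    exact congrArg (chartDeriv he' hq') ((chartDeriv he hq).symm_apply_apply v)
  intro w hw
  have h1 := formCurvature_comp ((contDiffAt_coordinateChange he he' hq hq').of_le
    ENat.LEInfty.out) hA' ha' hA ha (localVector e ⟨q, v⟩) w
  have h2 := h (fderiv ℝ (e' ∘ e.symm) (e q) w) (by
    have h3 : localForm γ e (e q) w =
        localForm γ e' ((e' ∘ e.symm) (e q)) (fderiv ℝ (e' ∘ e.symm) (e q) w) :=
      DFunLike.congr_fun hA.self_of_nhds w
    rw [hφq] at h3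
    exact h3.symm.trans hw)
  have h4 := congrArg (momentumDefect G L p₀ ⟨q, v⟩) h1
  rw [hvec] at h4
  refine h4.trans ?_
  rw [← h2]
  exact congrArg (fun y => momentumDefect G L p₀ ⟨q, v⟩ (formCurvature (localForm γ e')
    (localDrift γ Z e') y (localVector e' ⟨q, v⟩) (fderiv ℝ (e' ∘ e.symm) (e q) w))) hφq

/-- Along a nonholonomic solution, the vakonomic equation is the curvature condition. -/
theorem vakonomic_equation_iff [FiniteDimensional ℝ B] [FiniteDimensional ℝ F]
    [IsManifold 𝓘(ℝ, F) ∞ G] [ContMDiffSMul 𝓘(ℝ, F) 𝓘(ℝ, B × F) ∞ G Q]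
    {L : TangentBundle 𝓘(ℝ, B × F) Q → ℝ}
    (hL : ContMDiff 𝓘(ℝ, B × F).tangent 𝓘(ℝ, ℝ) ∞ L)
    (hLinv : ∀ (g : G) (v : TangentBundle 𝓘(ℝ, B × F) Q), L (liftAction B F G Q g v) = L v)
    {γ : PrincipalConnection B F G Q}
    {Z : ∀ q : Q, TangentSpace 𝓘(ℝ, B × F) q}
    (hZ : ContMDiff 𝓘(ℝ, B × F) 𝓘(ℝ, B × F).tangent ∞
      (fun q : Q => (⟨q, Z q⟩ : TangentBundle 𝓘(ℝ, B × F) Q)))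
    (hM : ∀ (g : G), ∀ v ∈ affineConstraint γ Z, liftAction B F G Q g v ∈ affineConstraint γ Z)
    {J : Set ℝ} (hJ : IsOpen J) {q : ℝ → Q} (hq : IsNonholonomicSolution γ Z L J q)
    (p₀ : F →L[ℝ] ℝ) {t : ℝ} (ht : t ∈ J) {e : OpenPartialHomeomorph Q (B × F)}
    (he : e ∈ IsManifold.maximalAtlas 𝓘(ℝ, B × F) ∞ Q) (hqt : q t ∈ e.source) :
    (DifferentiableAt ℝ (localCurve e (velocity q) (fun t => covectorW₁ γ L p₀ (velocity q t))) t ∧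
    ∀ δ : (B × F) × ((B × F) →L[ℝ] ℝ) × (B × F),
      fderiv ℝ (localConstraint γ Z e) (e (q t), localVector e (velocity q t)) (δ.1, δ.2.2) = 0 →
      presymplectic (deriv (localCurve e (velocity q)
          (fun t => covectorW₁ γ L p₀ (velocity q t))) t) δ =
        fderiv ℝ (localHamiltonian (localLagrangian L e)) (localCurve e (velocity q)
          (fun t => covectorW₁ γ L p₀ (velocity q t)) t) δ) ↔
    CurvatureCondition γ Z L p₀ (velocity q t) e := by
  have hqc : ∀ s ∈ J, ContMDiffAt 𝓘(ℝ, ℝ) 𝓘(ℝ, B × F) 2 q s := fun s hs =>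
    hq.contMDiffOn.contMDiffAt (hJ.mem_nhds hs)
  set x : ℝ → B × F := fun s => e (q s) with hx
  have hxc : ∀ s ∈ J, q s ∈ e.source → ContDiffAt ℝ 2 x s := by
    intro s hs hqs
    rw [← contMDiffAt_iff_contDiffAt]
    exact ContMDiffAt.comp (I' := 𝓘(ℝ, B × F)) s
      ((contMDiffAt_of_mem_maximalAtlas he hqs).of_le ENat.LEInfty.out) (hqc s hs)
  have hvel : ∀ s ∈ J, q s ∈ e.source → localVector e (velocity q s) = deriv x s := by
    intro s hs hqs
    have h1 := ((hqc s hs).mdifferentiableAt (by simp)).hasMFDerivAt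
    have h2 := ((mdifferentiable_of_mem_maximalAtlas he).mdifferentiableAt hqs).hasMFDerivAt
    let T : ℝ →L[ℝ] (B × F) := mfderiv 𝓘(ℝ, ℝ) 𝓘(ℝ, B × F) q s
    have h3 := HasMFDerivAt.comp s h2 h1
    have h4 : HasFDerivAt x ((chartDeriv he hqs : (B × F) →L[ℝ] (B × F)).comp T) s :=
      h3.hasFDerivAt
    exact h4.hasDerivAt.deriv.symm
  have hmom : ∀ s ∈ J, q s ∈ e.source →
      localCovector e (q s) (fiberDeriv L (velocity q s)) =
        momentum (localLagrangian L e) x s := by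
    intro s hs hqs
    have h1 := localCovector_fiberDeriv hL he (velocity q s) hqs
    rw [hvel s hs hqs] at h1
    exact h1
  have hcov : ∀ s ∈ J, q s ∈ e.source →
      localCovector e (q s) (covectorW₁ γ L p₀ (velocity q s)) =
        correctedMomentum (localLagrangian L e) (localForm γ e) (localGenerator (G := G) e) p₀ x s := by
    intro s hs hqs
    have h1 := localCovector_covectorW₁ (L := L) γ he p₀ (velocity q s) hqs
    change localCovector e (q s) (covectorW₁ γ L p₀ (velocity q s)) = _ at h1
    rw [h1]
    change localCovector e (q s) (fiberDeriv L (velocity q s)) +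
      (p₀ - (localCovector e (q s) (fiberDeriv L (velocity q s))).comp _).comp _ = _
    rw [hmom s hs hqs]
    rfl
  have hdef : p₀ - (momentum (localLagrangian L e) x t).comp (localGenerator (G := G) e (x t)) =
      momentumDefect G L p₀ (velocity q t) := by
    rw [← localCovector_comp_localGenerator L he p₀ (velocity q t) hqt, ← hmom t ht hqt]
    rfl
  have hev : ∀ᶠ s in 𝓝 t, s ∈ J ∧ q s ∈ e.source :=
    (hJ.eventually_mem ht).and ((hqc t ht).continuousAt.eventually_mem (e.open_source.mem_nhds hqt))
  have hcurve : localCurve e (velocity q) (fun t => covectorW₁ γ L p₀ (velocity q t)) =ᶠ[𝓝 t]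
      fun s => (x s, correctedMomentum (localLagrangian L e) (localForm γ e)
        (localGenerator (G := G) e) p₀ x s, deriv x s) := by
    filter_upwards [hev] with s hs
    exact Prod.ext rfl (Prod.ext (hcov s hs.1 hs.2) (hvel s hs.1 hs.2))
  have hxt : x t ∈ e.target := e.map_source hqt
  have hℓs : ContDiffAt ℝ ∞ (localLagrangian L e) (x t, deriv x t) :=
    contDiffAt_localLagrangian hL he hxt
  have hℓ : ContDiffAt ℝ 2 (localLagrangian L e) (x t, deriv x t) := hℓs.of_le ENat.LEInfty.out
  have hA : DifferentiableAt ℝ (localForm γ e) (x t) :=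
    ((contDiffOn_localForm γ he).contDiffAt (e.open_target.mem_nhds hxt)).differentiableAt (by simp)
  have ha : DifferentiableAt ℝ (localDrift γ Z e) (x t) :=
    ((contDiffOn_localDrift γ hZ he).contDiffAt (e.open_target.mem_nhds hxt)).differentiableAt
      (by simp)
  have hC : DifferentiableAt ℝ (localGenerator (G := G) e) (x t) :=
    ((contDiffOn_localGenerator he).contDiffAt (e.open_target.mem_nhds hxt)).differentiableAt
      (by simp)
  have hpt := hasDerivAt_correctedMomentum hℓ (hxc t ht hqt) hA hC p₀
  have hcd := ((hxc t ht hqt).differentiableAt (by norm_num)).hasDerivAt.prodMk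
    (hpt.differentiableAt.hasDerivAt.prodMk
      (differentiableAt_deriv_of_contDiffAt (hxc t ht hqt)).hasDerivAt)
  have hcd' := hcd.congr_of_eventuallyEq hcurve
  have hbase : (⟨e.symm (x t), mfderiv 𝓘(ℝ, B × F) 𝓘(ℝ, B × F) e.symm (x t) (deriv x t)⟩ :
      TangentBundle 𝓘(ℝ, B × F) Q) = velocity q t :=
     tangentBundle_mk_congr (e.left_inv hqt)
      ((congrArg (chartDeriv he hqt).symm (hvel t ht hqt).symm).trans
        ((chartDeriv he hqt).symm_apply_apply _))
  have hinv : ∀ η, fderiv ℝ (localLagrangian L e) (x t, deriv x t)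
      (localGenerator (G := G) e (x t) η,
        fderiv ℝ (localGenerator (G := G) e) (x t) (deriv x t) η) = 0 := fun η =>
    fderiv_eq_zero_of_liftAction_invariant he hL hxt (deriv x t) (fun g => hLinv g _) η
  have hinv' : ∀ η, fderiv ℝ (localConstraint γ Z e) (x t, deriv x t)
      (localGenerator (G := G) e (x t) η,
        fderiv ℝ (localGenerator (G := G) e) (x t) (deriv x t) η) = 0 := by
    intro η
    -- The constraint function is zero at the velocity and, as M is invariant, at all its
    -- translates. So it is constant on this orbit, which is all the invariance that is needed.
    have h1 : ∀ (g : G) (v : TangentBundle 𝓘(ℝ, B × F) Q), v = velocity q t →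
        modelForm γ (liftAction B F G Q g v).proj
          ((liftAction B F G Q g v).2 - Z (liftAction B F G Q g v).proj) =
        modelForm γ v.proj (v.2 - Z v.proj) := by
      rintro g _ rfl
      exact (hM g _ (hq.velocity_mem t ht)).trans (hq.velocity_mem t ht).symm
    exact fderiv_eq_zero_of_liftAction_invariant he (contMDiff_constraint γ hZ) hxt (deriv x t)
      (fun g => h1 g _ hbase) η
  obtain ⟨lam, hlam⟩ := hq.equation t ht e he hqt
  have heq : deriv (momentum (localLagrangian L e) x) t -
      (fderiv ℝ (localLagrangian L e) (x t, deriv x t)).comp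
        (ContinuousLinearMap.inl ℝ (B × F) (B × F)) = lam.comp (localForm γ e (x t)) := by
    refine hlam.trans ?_
    rw [localConstraint_eq]
    refine ContinuousLinearMap.ext fun w => ?_
    change lam (fderiv ℝ (fun y : (B × F) × (B × F) => localForm γ e y.1 y.2 - localDrift γ Z e y.1)
      (x t, deriv x t) (0, w)) = lam (localForm γ e (x t) w)
    rw [fderiv_affine_apply hA ha]
    simp
  rw [localConstraint_eq] at hinv' ⊢
  have key := vakonomic_iff_formCurvature hℓ (hxc t ht hqt) hA ha hC p₀
    (by filter_upwards [e.open_target.mem_nhds hxt] with y hy using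
      localForm_localGenerator γ he hy) hinv hinv' lam heq
  have hgoal : CurvatureCondition γ Z L p₀ (velocity q t) e ↔ ∀ w, localForm γ e (x t) w = 0 →
      (p₀ - (momentum (localLagrangian L e) x t).comp (localGenerator (G := G) e (x t)))
        (formCurvature (localForm γ e) (localDrift γ Z e) (x t) (deriv x t) w) = 0 := by
    rw [hdef, ← hvel t ht hqt]
    rfl
  rw [hgoal, ← key, hvel t ht hqt, hcd'.deriv, hcurve.self_of_nhds]
  set P := correctedMomentum (localLagrangian L e) (localForm γ e) (localGenerator (G := G) e) p₀ x
  have hH : ∀ δ : (B × F) × ((B × F) →L[ℝ] ℝ) × (B × F),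
      fderiv ℝ (localHamiltonian (localLagrangian L e)) (x t, P t, deriv x t) δ =
        P t δ.2.2 + δ.2.1 (deriv x t) -
          fderiv ℝ (localLagrangian L e) (x t, deriv x t) (δ.1, δ.2.2) := by
    intro δ
    have h2 := (hasFDerivAt_fst (𝕜 := ℝ) (p := (P t, deriv x t))).clm_apply
      (hasFDerivAt_snd (𝕜 := ℝ) (p := (P t, deriv x t)))
    have h3 := HasFDerivAt.comp (x t, P t, deriv x t) (f := Prod.snd) h2 hasFDerivAt_snd
    have h4 : HasFDerivAt
        (fun w : (B × F) × ((B × F) →L[ℝ] ℝ) × (B × F) => (w.1, w.2.2))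
        ((ContinuousLinearMap.fst ℝ _ _).prod
          ((ContinuousLinearMap.snd ℝ _ _).comp (ContinuousLinearMap.snd ℝ _ _)))
        (x t, P t, deriv x t) :=
      ((ContinuousLinearMap.fst ℝ (B × F) (((B × F) →L[ℝ] ℝ) × (B × F))).prod
          ((ContinuousLinearMap.snd ℝ ((B × F) →L[ℝ] ℝ) (B × F)).comp
            (ContinuousLinearMap.snd ℝ _ _))).hasFDerivAt
    have h5 := HasFDerivAt.comp (x t, P t, deriv x t) (g := localLagrangian L e)
      (hℓs.differentiableAt (by simp)).hasFDerivAt h4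
    have h6 := (h3.sub h5).fderiv
    have h7 := DFunLike.congr_fun h6 δ
    refine Eq.trans h7 ?_
    simp
  constructor
  · rintro ⟨-, h⟩ y z hyz
    -- The covector component may be taken zero: its contributions to the two sides agree for every
    -- choice, the velocity component being the derivative of x.
    have h1 := h (y, 0, z) hyz
    rw [hH] at h1
    simpa [presymplectic] using h1
  · intro h
    refine ⟨hcd'.differentiableAt, fun δ hδ => ?_⟩
    have h1 := h δ.1 δ.2.2 hδ
    rw [hH, presymplectic]
    dsimp only
    linarith

end CurvatureCondition

/-! ### A linear normal form for surjections onto F. -/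

section LinearAlgebra

variable {B F : Type*} [NormedAddCommGroup B] [NormedSpace ℝ B] [FiniteDimensional ℝ B]
  [NormedAddCommGroup F] [NormedSpace ℝ F] [FiniteDimensional ℝ F]

/-- A linear map onto `F` is the second projection in suitable linear coordinates. -/
theorem exists_equiv_apply_eq_snd (A : (B × F) →L[ℝ] F) (C : F →L[ℝ] (B × F))
    (hAC : ∀ η, A (C η) = η) : ∃ T : (B × F) ≃L[ℝ] (B × F), ∀ w, A (T w) = w.2 := by
  have hsurj : Function.Surjective A.toLinearMap := fun η => ⟨C η, hAC η⟩
  -- The kernel of A has the dimension of B, so B can be identified with it; this identification on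
  -- B together with C on F is the required T.
  have hrank : Module.finrank ℝ B = Module.finrank ℝ (LinearMap.ker A.toLinearMap) := by
    have h1 := A.toLinearMap.finrank_range_add_finrank_ker
    rw [LinearMap.range_eq_top.2 hsurj, finrank_top, Module.finrank_prod] at h1
    omega
  let ι : B ≃ₗ[ℝ] LinearMap.ker A.toLinearMap := LinearEquiv.ofFinrankEq _ _ hrank
  let T : (B × F) →ₗ[ℝ] (B × F) :=
    ((LinearMap.ker A.toLinearMap).subtype.comp ι.toLinearMap).coprod C.toLinearMap
  have hT : ∀ w, T w = ι w.1 + C w.2 := fun w => rfl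
  have hAT : ∀ w, A (T w) = w.2 := by
    intro w
    have h1 : A (ι w.1 : B × F) = 0 := (ι w.1).2
    rw [hT, map_add, h1, hAC, zero_add]
  have hinj : Function.Injective T := by
    rw [← LinearMap.ker_eq_bot, LinearMap.ker_eq_bot']
    intro w hw
    have h2 : w.2 = 0 := by rw [← hAT w, hw, map_zero]
    have h1 : (ι w.1 : B × F) = 0 := by
      have := hT w
      rwa [hw, h2, map_zero, add_zero, eq_comm] at this
    have h3 : w.1 = 0 := by
      rw [← ι.map_eq_zero_iff]
      exact Subtype.ext h1
    exact Prod.ext h3 h2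
  exact ⟨(LinearEquiv.ofInjectiveEndo T hinj).toContinuousLinearEquiv, hAT⟩

end LinearAlgebra

/-! ### Adapted coordinates: the functions g_b and existence. -/

section Adapted

variable {B F G : Type*}
  [NormedAddCommGroup B] [NormedSpace ℝ B] [NormedAddCommGroup F] [NormedSpace ℝ F]
  [TopologicalSpace G] [ChartedSpace F G] [Group G]
  {Q : Type*} [TopologicalSpace Q] [ChartedSpace (B × F) Q] [MulAction G Q]
  [IsManifold 𝓘(ℝ, B × F) ∞ Q]

theorem mem_affineConstraint_iff {γ : PrincipalConnection B F G Q}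
    {Z : ∀ q : Q, TangentSpace 𝓘(ℝ, B × F) q} {e : OpenPartialHomeomorph Q (B × F)}
    (he : e ∈ IsManifold.maximalAtlas 𝓘(ℝ, B × F) ∞ Q) (v : TangentBundle 𝓘(ℝ, B × F) Q)
    (hq : v.proj ∈ e.source) :
    v ∈ affineConstraint γ Z ↔
      localForm γ e (e v.proj) (localVector e v) = localDrift γ Z e (e v.proj) := by
  have h1 : v ∈ affineConstraint γ Z ↔ modelForm γ v.proj (v.2 - Z v.proj) = 0 := Iff.rfl
  have h2 : modelForm γ v.proj (v.2 - Z v.proj) =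
      modelForm γ v.proj v.2 - modelForm γ v.proj (Z v.proj) := map_sub (modelForm γ v.proj) _ _
  have h3 : localForm γ e (e v.proj) (localVector e v) = modelForm γ v.proj v.2 := by
    rw [localForm_chart γ he hq]
    exact congrArg (modelForm γ v.proj) ((chartDeriv he hq).symm_apply_apply v.2)
  rw [h1, h2, h3, localDrift_chart γ Z hq, sub_eq_zero]

namespace AdaptedCoordinates

variable {γ : PrincipalConnection B F G Q} {Z : ∀ q : Q, TangentSpace 𝓘(ℝ, B × F) q}

theorem localForm_eq_localDrift_iff (c : AdaptedCoordinates γ Z) {x : B × F}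
    (hx : x ∈ c.chart.target) (z : B × F) :
    localForm γ c.chart x z = localDrift γ Z c.chart x ↔ z.2 = c.Ψ x z.1 + c.ψ x := by
  have he := c.mem_maximalAtlas
  have hq := c.chart.map_target hx
  let v : TangentBundle 𝓘(ℝ, B × F) Q := ⟨c.chart.symm x, (chartDeriv he hq).symm z⟩
  have h1 := c.mem_iff v hq
  rw [mem_affineConstraint_iff he v hq] at h1
  have h2 : localVector c.chart v = z := (chartDeriv he hq).apply_symm_apply z
  have h3 : c.chart v.proj = x := c.chart.right_inv hx
  rwa [h2, h3] at h1

theorem localDrift_eq (c : AdaptedCoordinates γ Z) {x : B × F} (hx : x ∈ c.chart.target) :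
    localDrift γ Z c.chart x = localForm γ c.chart x (0, c.ψ x) :=
  ((c.localForm_eq_localDrift_iff hx (0, c.ψ x)).2 (by simp)).symm

/-- Translating by the particular solution (0, ψ) reduces the linear equation to the affine one. -/
theorem localForm_eq_zero_iff (c : AdaptedCoordinates γ Z) {x : B × F} (hx : x ∈ c.chart.target)
    (z : B × F) : localForm γ c.chart x z = 0 ↔ z.2 = c.Ψ x z.1 := by
  have h1 := c.localForm_eq_localDrift_iff hx (z + (0, c.ψ x))
  rw [map_add, c.localDrift_eq hx] at h1
  simpa using h1

/-- The form vanishes on the graph of Ψ, hence is determined by its restriction N to F; this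
supplies the factorization for `formCurvature_graph`. -/
theorem localForm_eq (c : AdaptedCoordinates γ Z) {x : B × F} (hx : x ∈ c.chart.target) :
    localForm γ c.chart x = ((localForm γ c.chart x).comp (ContinuousLinearMap.inr ℝ B F)).comp
      (ContinuousLinearMap.snd ℝ B F - (c.Ψ x).comp (ContinuousLinearMap.fst ℝ B F)) := by
  refine ContinuousLinearMap.ext fun z => ?_
  have h1 : localForm γ c.chart x (z.1, c.Ψ x z.1) = 0 := (c.localForm_eq_zero_iff hx _).2 rfl
  have h2 : z = (z.1, c.Ψ x z.1) + (0, z.2 - c.Ψ x z.1) := by ext <;> simp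
  conv_lhs => rw [h2, map_add, h1, zero_add]
  rfl

/-- The functions `g_b` are the components of the curvature condition. -/
theorem g_eq_zero_iff [FiniteDimensional ℝ B] [FiniteDimensional ℝ F]
    (c : AdaptedCoordinates γ Z) (L : TangentBundle 𝓘(ℝ, B × F) Q → ℝ) (p₀ : F →L[ℝ] ℝ)
    (v : TangentBundle 𝓘(ℝ, B × F) Q) (hv : v ∈ affineConstraint γ Z)
    (hq : v.proj ∈ c.chart.source) :
    (∀ w : B, c.g L v (covectorW₁ γ L p₀ v) w = 0) ↔ CurvatureCondition γ Z L p₀ v c.chart := by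
  have he := c.mem_maximalAtlas
  have hx := c.chart.map_source hq
  have hnhds := c.chart.open_target.mem_nhds hx
  set x := c.chart v.proj with hxdef
  have hvec : localVector c.chart v = ((localVector c.chart v).1,
      c.Ψ x (localVector c.chart v).1 + c.ψ x) :=
    Prod.ext rfl ((c.mem_iff v hq).1 hv)
  have hN : DifferentiableAt ℝ (fun y => (localForm γ c.chart y).comp
      (ContinuousLinearMap.inr ℝ B F)) x :=
    (((contDiffOn_localForm γ he).contDiffAt hnhds).differentiableAt (by simp)).clm_comp
      (differentiableAt_const _)
  have hcurv := fun w : B => formCurvature_graph hN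
    ((c.smooth_Ψ.contDiffAt hnhds).differentiableAt (by simp))
    ((c.smooth_ψ.contDiffAt hnhds).differentiableAt (by simp))
    (by filter_upwards [hnhds] with y hy using c.localForm_eq hy)
    (by filter_upwards [hnhds] with y hy using c.localDrift_eq hy) (localVector c.chart v).1 w
  have hg : ∀ w : B, c.g L v (covectorW₁ γ L p₀ v) w = - momentumDefect G L p₀ v
      (formCurvature (localForm γ c.chart) (localDrift γ Z c.chart) x
        (localVector c.chart v) (w, c.Ψ x w)) := by
    intro w
    rw [hvec, hcurv w, map_neg, neg_neg]
    -- By construction p − FL(v) is the momentum defect composed with γ; this brings the defect into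
    -- g_b, and N with it.
    have h1 : ((covectorW₁ γ L p₀ v - fiberDeriv L v : TangentSpace 𝓘(ℝ, B × F) v.proj →L[ℝ] ℝ) :
        (B × F) →L[ℝ] ℝ) = (momentumDefect G L p₀ v).comp (modelForm γ v.proj) :=
      add_sub_cancel_left (fiberDeriv L v) _
    have h2 := localCovector_eq he hq (covectorW₁ γ L p₀ v - fiberDeriv L v)
    have h3 : localCovector c.chart v.proj (covectorW₁ γ L p₀ v - fiberDeriv L v) =
        (momentumDefect G L p₀ v).comp (localForm γ c.chart x) := by
      rw [h2, hxdef, localForm_chart γ he hq]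
      exact congrArg (fun p : (B × F) →L[ℝ] ℝ => p.comp
        ((chartDeriv he hq).symm : (B × F) →L[ℝ] (B × F))) h1
    rw [g, h3]
    rfl
  constructor
  · intro h w hw
    have h1 : w = (w.1, c.Ψ x w.1) := Prod.ext rfl ((c.localForm_eq_zero_iff hx w).1 hw)
    rw [h1]
    exact neg_eq_zero.1 ((hg w.1).symm.trans (h w.1))
  · intro h w
    rw [hg w, neg_eq_zero]
    exact h _ ((c.localForm_eq_zero_iff hx _).2 rfl)

end AdaptedCoordinates

/-- A coordinate system in which the constraint can be solved for the `F`-part of the velocity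
is adapted. -/
theorem exists_adaptedCoordinates_of_isInvertible [FiniteDimensional ℝ B] [FiniteDimensional ℝ F]
    {γ : PrincipalConnection B F G Q} {Z : ∀ q : Q, TangentSpace 𝓘(ℝ, B × F) q}
    (hZ : ContMDiff 𝓘(ℝ, B × F) 𝓘(ℝ, B × F).tangent ∞
      (fun q : Q => (⟨q, Z q⟩ : TangentBundle 𝓘(ℝ, B × F) Q)))
    {e : OpenPartialHomeomorph Q (B × F)}
    (he : e ∈ IsManifold.maximalAtlas 𝓘(ℝ, B × F) ∞ Q)
    (hinv : ∀ x ∈ e.target,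
      ((localForm γ e x).comp (ContinuousLinearMap.inr ℝ B F)).IsInvertible) :
    ∃ c : AdaptedCoordinates γ Z, c.chart = e := by
  have : CompleteSpace F := FiniteDimensional.complete ℝ F
  have hN : ContDiffOn ℝ ∞ (fun x => ((localForm γ e x).comp
      (ContinuousLinearMap.inr ℝ B F)).inverse) e.target := by
    intro x hx
    obtain ⟨K, hK⟩ := hinv x hx
    have h1 : ContDiffWithinAt ℝ ∞ (fun x => (localForm γ e x).comp
        (ContinuousLinearMap.inr ℝ B F)) e.target x :=
      (contDiffOn_localForm γ he x hx).clm_comp contDiffWithinAt_const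
    have h2 := contDiffAt_map_inverse (𝕜 := ℝ) (n := ∞) K
    rw [hK] at h2
    exact ContDiffAt.comp_contDiffWithinAt x h2 h1
  -- Writing A = (A_B, N), the constraint A_B ẋ_B + N ẋ_F = a is solved by Ψ = −N⁻¹A_B and ψ = N⁻¹a.
  refine ⟨{
    chart := e
    mem_maximalAtlas := he
    Ψ := fun x => -((localForm γ e x).comp (ContinuousLinearMap.inr ℝ B F)).inverse.comp
      ((localForm γ e x).comp (ContinuousLinearMap.inl ℝ B F))
    ψ := fun x => ((localForm γ e x).comp (ContinuousLinearMap.inr ℝ B F)).inverse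
      (localDrift γ Z e x)
    smooth_Ψ := (hN.clm_comp ((contDiffOn_localForm γ he).clm_comp contDiffOn_const)).neg
    smooth_ψ := hN.clm_apply (contDiffOn_localDrift γ hZ he)
    mem_iff := ?_ }, rfl⟩
  intro v hq
  rw [mem_affineConstraint_iff he v hq]
  obtain ⟨K, hK⟩ := hinv _ (e.map_source hq)
  set z := localVector e v
  have h1 : localForm γ e (e v.proj) z = localForm γ e (e v.proj) (z.1, 0) + K z.2 := by
    have h2 : K z.2 = localForm γ e (e v.proj) (0, z.2) :=
      DFunLike.congr_fun hK z.2
    rw [h2, ← map_add]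
    simp
  rw [← hK, ContinuousLinearMap.inverse_equiv, h1]
  simp only [_root_.neg_apply, ContinuousLinearMap.comp_apply, ContinuousLinearMap.inl_apply,
    ContinuousLinearEquiv.coe_coe]
  rw [← map_neg, ← map_add, K.eq_symm_apply]
  constructor
  · intro h; rw [← h]; abel
  · intro h; rw [h]; abel

/-- A linear automorphism after any chart turns A at the single point q into the second projection;
no integrability of the horizontal distribution is involved. -/
theorem exists_chart_localForm_inr_eq_id [FiniteDimensional ℝ B] [FiniteDimensional ℝ F]
    (γ : PrincipalConnection B F G Q) (q : Q) :
    ∃ e ∈ IsManifold.maximalAtlas 𝓘(ℝ, B × F) ∞ Q, q ∈ e.source ∧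
      (localForm γ e (e q)).comp (ContinuousLinearMap.inr ℝ B F) = ContinuousLinearMap.id ℝ F := by
  let e₀ := chartAt (B × F) q
  have he₀ : e₀ ∈ IsManifold.maximalAtlas 𝓘(ℝ, B × F) ∞ Q := IsManifold.chart_mem_maximalAtlas q
  have hq : q ∈ e₀.source := mem_chart_source _ q
  obtain ⟨T, hT⟩ := exists_equiv_apply_eq_snd _ _
    (localForm_localGenerator γ he₀ (e₀.map_source hq))
  let e := e₀.trans T.symm.toHomeomorph.toOpenPartialHomeomorph
  have hsource : e.source = e₀.source := by simp [e]
  have htarget : e.target = T ⁻¹' e₀.target := by simp [e]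
  have he : e ∈ IsManifold.maximalAtlas 𝓘(ℝ, B × F) ∞ Q := by
    refine e.mem_maximalAtlas_of_contMDiffOn ?_ ?_
    · rw [hsource]
      exact T.symm.contDiff.contMDiff.comp_contMDiffOn (contMDiffOn_of_mem_maximalAtlas he₀)
    · rw [htarget]
      exact (contMDiffOn_symm_of_mem_maximalAtlas he₀).comp T.contDiff.contMDiff.contMDiffOn
        (fun x hx => hx)
  refine ⟨e, he, by rwa [hsource], ?_⟩
  have hT' : T (e q) = e₀ q := T.apply_symm_apply _
  have h1 : HasMFDerivAt 𝓘(ℝ, B × F) 𝓘(ℝ, B × F) T (e q) (T : (B × F) →L[ℝ] (B × F)) :=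
    T.hasFDerivAt.hasMFDerivAt
  have h2 : HasMFDerivAt 𝓘(ℝ, B × F) 𝓘(ℝ, B × F) e₀.symm (T (e q))
      ((chartDeriv he₀ hq).symm : (B × F) →L[ℝ] (B × F)) := by
    rw [hT']
    exact ((mdifferentiable_of_mem_maximalAtlas he₀).mdifferentiableAt_symm
      (e₀.map_source hq)).hasMFDerivAt
  have h3 : (mfderiv 𝓘(ℝ, B × F) 𝓘(ℝ, B × F) e.symm (e q) : (B × F) →L[ℝ] (B × F)) =
      ((chartDeriv he₀ hq).symm : (B × F) →L[ℝ] (B × F)).comp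
        (T : (B × F) →L[ℝ] (B × F)) := (HasMFDerivAt.comp (e q) h2 h1).mfderiv
  have hqe : q ∈ e.source := by rwa [hsource]
  have h4 : localForm γ e (e q) = (localForm γ e₀ (e₀ q)).comp
      (T : (B × F) →L[ℝ] (B × F)) := by
    rw [localForm_chart γ he hqe, localForm_chart γ he₀ hq, coe_chartDeriv_symm]
    exact congrArg (modelForm γ q).comp h3
  rw [h4]
  refine ContinuousLinearMap.ext fun η => ?_
  exact hT (0, η)

/-- Adapted coordinates exist around every point. -/
theorem exists_adaptedCoordinates [FiniteDimensional ℝ B] [FiniteDimensional ℝ F]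
    (γ : PrincipalConnection B F G Q) {Z : ∀ q : Q, TangentSpace 𝓘(ℝ, B × F) q}
    (hZ : ContMDiff 𝓘(ℝ, B × F) 𝓘(ℝ, B × F).tangent ∞
      (fun q : Q => (⟨q, Z q⟩ : TangentBundle 𝓘(ℝ, B × F) Q))) (q : Q) :
    ∃ c : AdaptedCoordinates γ Z, q ∈ c.chart.source := by
  have : CompleteSpace F := FiniteDimensional.complete ℝ F
  obtain ⟨e, he, hq, hid⟩ := exists_chart_localForm_inr_eq_id γ q
  let N : B × F → F →L[ℝ] F := fun x => (localForm γ e x).comp (ContinuousLinearMap.inr ℝ B F)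
  have hN : ContinuousOn N e.target :=
    ((contDiffOn_localForm γ he).clm_comp contDiffOn_const).continuousOn
  -- Invertibility of N is an open condition and N is the identity at q, so the chart is restricted
  -- to where N is invertible.
  let V : Set (B × F) := e.target ∩ N ⁻¹' range ((↑) : (F ≃L[ℝ] F) → F →L[ℝ] F)
  have hV : IsOpen V := hN.isOpen_inter_preimage e.open_target ContinuousLinearEquiv.isOpen
  let S : Set Q := e.source ∩ e ⁻¹' V
  have hS : IsOpen S := e.isOpen_inter_preimage hV
  have heS : e.restr S ∈ IsManifold.maximalAtlas 𝓘(ℝ, B × F) ∞ Q :=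
    restr_mem_maximalAtlas _ he hS
  obtain ⟨c, hc⟩ := exists_adaptedCoordinates_of_isInvertible (γ := γ) hZ heS (by
    intro x hx
    have hx' : e.symm x ∈ S ∧ x ∈ e.target := by
      rw [e.restr_target, hS.interior_eq] at hx
      exact ⟨hx.2, hx.1⟩
    have h1 : e (e.symm x) ∈ V := hx'.1.2
    rw [e.right_inv hx'.2] at h1
    exact h1.2)
  refine ⟨c, ?_⟩
  rw [hc, e.restr_source, hS.interior_eq]
  exact ⟨hq, hq, e.map_source hq, ContinuousLinearEquiv.refl ℝ F, hid.symm⟩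

end Adapted

end ConstrainedMechanics

/-! ### The three equivalent conditions. -/

theorem mainTheorem10 {B F G Q : Type*}
    [NormedAddCommGroup B] [NormedSpace ℝ B] [FiniteDimensional ℝ B]
    [NormedAddCommGroup F] [NormedSpace ℝ F] [FiniteDimensional ℝ F]
    [TopologicalSpace G] [ChartedSpace F G] [Group G] [LieGroup 𝓘(ℝ, F) ∞ G]
    [TopologicalSpace Q] [ChartedSpace (B × F) Q] [IsManifold 𝓘(ℝ, B × F) ∞ Q]
    [MulAction G Q] [ContMDiffSMul 𝓘(ℝ, F) 𝓘(ℝ, B × F) ∞ G Q] [ProperSMul G Q]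
    (hfree : ∀ (g : G) (q : Q), g • q = q → g = 1)
    (L : TangentBundle 𝓘(ℝ, B × F) Q → ℝ)
    (hL : ContMDiff 𝓘(ℝ, B × F).tangent 𝓘(ℝ, ℝ) ∞ L)
    (hLinv : ∀ (g : G) (v : TangentBundle 𝓘(ℝ, B × F) Q), L (liftAction B F G Q g v) = L v)
    (γ : PrincipalConnection B F G Q)
    (Z : ∀ q : Q, TangentSpace 𝓘(ℝ, B × F) q)
    (hZ : ContMDiff 𝓘(ℝ, B × F) 𝓘(ℝ, B × F).tangent ∞
      (fun q : Q => (⟨q, Z q⟩ : TangentBundle 𝓘(ℝ, B × F) Q)))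
    (hM : ∀ (g : G), ∀ v ∈ affineConstraint γ Z, liftAction B F G Q g v ∈ affineConstraint γ Z)
    (hcompat : Compatible γ Z L)
    (J : Set ℝ) (hJ : IsOpen J) (hJc : J.OrdConnected)
    (q : ℝ → Q) (hq : IsNonholonomicSolution γ Z L J q)
    (p₀ : GroupLieAlgebra 𝓘(ℝ, F) G →L[ℝ] ℝ) :
    List.TFAE [
      ∀ t ∈ J, ∀ c : AdaptedCoordinates γ Z, q t ∈ c.chart.source →
        ∀ w : B, c.g L (velocity q t) (covectorW₁ γ L p₀ (velocity q t)) w = 0,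
      ∀ t ∈ J, ∃ c : AdaptedCoordinates γ Z, q t ∈ c.chart.source ∧
        ∀ w : B, c.g L (velocity q t) (covectorW₁ γ L p₀ (velocity q t)) w = 0,
      IsVakonomicSolution γ Z L J (velocity q) (fun t => covectorW₁ γ L p₀ (velocity q t))] := by
  have hequiv := fun t (ht : t ∈ J) (e : OpenPartialHomeomorph Q (B × F))
      (he : e ∈ IsManifold.maximalAtlas 𝓘(ℝ, B × F) ∞ Q) (hqt : q t ∈ e.source) =>
    vakonomic_equation_iff hL hLinv hZ hM hJ hq p₀ ht he hqt
  tfae_have 1 → 2 := by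
    intro h t ht
    obtain ⟨c, hc⟩ := exists_adaptedCoordinates γ hZ (q t)
    exact ⟨c, hc, h t ht c hc⟩
  tfae_have 2 → 3 := by
    intro h
    refine ⟨fun t ht => memW₁_covectorW₁ γ Z L p₀ _ (hq.velocity_mem t ht),
      hq.contMDiffOn.continuousOn, fun t ht e he hqt => (hequiv t ht e he hqt).2 ?_⟩
    obtain ⟨c, hc, hg⟩ := h t ht
    -- The vakonomic equation is required in every chart `e`, while the hypothesis concerns one
    -- adapted chart; naturality carries the condition across.
    exact CurvatureCondition.coordinateChange hZ he c.mem_maximalAtlas hqt hc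
      ((c.g_eq_zero_iff L p₀ _ (hq.velocity_mem t ht) hc).1 hg)
  tfae_have 3 → 1 := by
    intro h t ht c hc
    exact (c.g_eq_zero_iff L p₀ _ (hq.velocity_mem t ht) hc).2
      ((hequiv t ht c.chart c.mem_maximalAtlas hc).1 (h.equation t ht c.chart c.mem_maximalAtlas hc))
  tfae_finish
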